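/- Let $\mathbf F$ be an algebraic closure of the field with two elements. Let $\cdots \to C_{i+1}\to C_i\to\cdots\to C_1\to C_0=\mathbb P^1$ be the tower of smooth projective curves over $\mathbf F$ in which $C_0$ has affine coordinate $x_0$ and, for every $i\ge 0$, the cover $C_{i+1}\to C_i$ is given by the affine equation $$x_{i+1}^2+x_{i+1}=x_i+1+\frac1{x_i};$$ that is, $C_i$ is the smooth projective curve over $\mathbf F$ with function field $\mathbf F(x_0,\dots,x_i)$, where $x_0$ is transcendental over $\mathbf F$. For $i\ge 0$ let $n_i$ be the number of points $P$ of $C_i$ that are totally ramified in $C_{i+1}/C_i$ (i.e. some point of $C_{i+1}$ above $P$ has ramification index equal to the degree of $C_{i+1}\to C_i$). Then $n_i$ is finite and $$n_i=\begin{cases}\left(\left[\frac{i+2}{4}\right]+2\right)2^{i/2} & \text{for } i \text{ even},\\[4pt] \left(\left[\frac{i}{4}\right]+2\right)2^{(i+1)/2} & \text{for } i \text{ odd},\end{cases}$$ where $[a]$ denotes the greatest integer not exceeding $a$. -/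

import Mathlib

/-- A point of the smooth projective curve over an algebraically closed field `k` with function
field `K`: a discrete valuation ring of `K` that contains `k` and has fraction field `K`. -/
structure CurvePoint (k K : Type*) [Field k] [Field K] [Algebra k K] where
  /-- The local ring of the point, as a subring of the function field. -/
  localRing : ValuationSubring K
  algebraMap_mem : ∀ c : k, algebraMap k K c ∈ localRing
  isDVR : IsDiscreteValuationRing localRing

namespace CurvePoint

/-- For an extension `L / K` of function fields, corresponding to a cover of curves, the point `Q`
of the upper curve is mapped to the point `P` of the lower one. -/
def LiesOver {k K L : Type*} [Field k] [Field K] [Field L] [Algebra k K] [Algebra k L]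
    [Algebra K L] (Q : CurvePoint k L) (P : CurvePoint k K) : Prop :=
  Q.localRing.comap (algebraMap K L) = P.localRing

/-- The homomorphism `O_P → O_Q` of local rings induced by a cover that maps `Q` to `P`. -/
def localHom {k K L : Type*} [Field k] [Field K] [Field L] [Algebra k K] [Algebra k L]
    [Algebra K L] {Q : CurvePoint k L} {P : CurvePoint k K} (h : Q.LiesOver P) :
    P.localRing →+* Q.localRing :=
  (algebraMap K L).restrict P.localRing Q.localRing (fun a ha => by
    have h' : Q.localRing.comap (algebraMap K L) = P.localRing := h
    rw [← h'] at ha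
    exact ha)

/-- `P` is totally ramified in the cover given by `L / K`: some point `Q` over `P` has ramification
index `[L : K]`, that is, `m_P O_Q = m_Q ^ [L : K]`. -/
def IsTotallyRamified {k K : Type*} [Field k] [Field K] [Algebra k K] (P : CurvePoint k K)
    (L : Type*) [Field L] [Algebra k L] [Algebra K L] : Prop :=
  ∃ (Q : CurvePoint k L) (h : Q.LiesOver P),
    (IsLocalRing.maximalIdeal P.localRing).map (localHom h) =
      IsLocalRing.maximalIdeal Q.localRing ^ Module.finrank K L

end CurvePoint

/-- `x₀` is transcendental over `F` (an affine coordinate on the projective line), and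
`x_{i+1}² + x_{i+1} = x_i + 1 + 1 / x_i` for all `i`. (All `x_i` are then nonzero.) -/
structure IsTowerSequence (F : Type*) {Ω : Type*} [Field F] [Field Ω] [Algebra F Ω]
    (x : ℕ → Ω) : Prop where
  transcendental_zero : Transcendental F (x 0)
  equation : ∀ i, x (i + 1) ^ 2 + x (i + 1) = x i + 1 + 1 / x i

/-- Tower sequences exist. -/
theorem exists_isTowerSequence (F : Type*) [Field F] :
    ∃ x : ℕ → AlgebraicClosure (RatFunc F), IsTowerSequence F x := by
  have key : ∀ a : AlgebraicClosure (RatFunc F), ∃ y : AlgebraicClosure (RatFunc F),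
      y ^ 2 + y = a + 1 + 1 / a := by
    intro a
    have hd : (Polynomial.X ^ 2 + Polynomial.X - Polynomial.C (a + 1 + 1 / a)).degree ≠ 0 := by
      have : (Polynomial.X ^ 2 + Polynomial.X - Polynomial.C (a + 1 + 1 / a)).degree = 2 := by
        compute_degree!
      rw [this]
      decide
    obtain ⟨y, hy⟩ := IsAlgClosed.exists_root _ hd
    refine ⟨y, ?_⟩
    simpa [Polynomial.IsRoot, sub_eq_zero] using hy
  choose g hg using key
  refine ⟨fun n => Nat.rec (algebraMap (RatFunc F) _ RatFunc.X) (fun _ a => g a) n, ?_, ?_⟩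
  · exact (transcendental_algebraMap_iff
      (algebraMap (RatFunc F) (AlgebraicClosure (RatFunc F))).injective).2 RatFunc.transcendental_X
  · intro i
    exact hg _

/-- The function field `F(x₀, …, x_i)` of the `i`-th curve `C_i` of the tower. -/
def towerField (F : Type*) {Ω : Type*} [Field F] [Field Ω] [Algebra F Ω] (x : ℕ → Ω) (i : ℕ) :
    IntermediateField F Ω :=
  IntermediateField.adjoin F {y | ∃ j ≤ i, y = x j}

theorem towerField_le_succ (F : Type*) {Ω : Type*} [Field F] [Field Ω] [Algebra F Ω]
    (x : ℕ → Ω) (i : ℕ) : towerField F x i ≤ towerField F x (i + 1) :=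
  IntermediateField.adjoin.mono F _ _ fun _ ⟨j, hj, hy⟩ => ⟨j, Nat.le_succ_of_le hj, hy⟩

/-- The inclusion of function fields given by the cover `C_{i+1} → C_i`. -/
noncomputable instance towerAlgebra (F : Type*) {Ω : Type*} [Field F] [Field Ω] [Algebra F Ω]
    (x : ℕ → Ω) (i : ℕ) : Algebra (towerField F x i) (towerField F x (i + 1)) :=
  (IntermediateField.inclusion (towerField_le_succ F x i)).toRingHom.toAlgebra

/-- The set of points of `C_i` that are totally ramified in `C_{i+1} / C_i`. -/
def totallyRamifiedPoints (F : Type*) {Ω : Type*} [Field F] [Field Ω] [Algebra F Ω]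
    (x : ℕ → Ω) (i : ℕ) : Set (CurvePoint F (towerField F x i)) :=
  {P | P.IsTotallyRamified (towerField F x (i + 1))}

/-!
In characteristic two, `C_{i+1} → C_i` is the Artin–Schreier cover `y² + y = f` with
`f = x_i + 1 + 1 / x_i`, which depends on `f` only up to adding functions `g² + g`. A point splits
if `f` can be made regular there in this way, and is totally ramified if `f` can be given a simple
pole.

The poles of `x_i` lie over the values `∞, 0, 1` and `ω` of `x₀`, with `ω² + ω + 1 = 0`: over `1`
the next coordinate takes the two values `ω`, over `ω` it takes the values `0` and `1`, and over `0`
it has a pole. The poles of `f` that arise have high order, but each passage from the value `1` to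
`ω` only replaces a function `r` by `ω (r² + r)` modulo regular functions. As `ω⁴ = ω` and
`ω² + ω = 1`, this is `r` again up to adding `(ω² r)² + ω² r`. So the number `m` of such passages
decides what happens at a pole: a ramified point with `m > 0` is followed by an unramified point,
which is followed by two ramified points with `m - 1`, while above a ramified point with `m = 0` all
points are ramified. Counting the points that are ramified at a given level is then a recursion in
`m` and the level.
-/

section Uniformizers

variable {K L : Type*} [Field K] [Field L] {A : ValuationSubring K} {s t z : K}

/-- `t` generates the value group of the valuation ring `A`, which is thereby infinite cyclic. -/
structure IsUniformizer (A : ValuationSubring K) (t : K) : Prop where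
  ne_zero : t ≠ 0
  valuation_lt_one : A.valuation t < 1
  exists_zpow : ∀ z : K, z ≠ 0 → ∃ n : ℤ, A.valuation z = A.valuation t ^ n

namespace IsUniformizer

theorem valuation_pos (ht : IsUniformizer A t) : 0 < A.valuation t :=
  A.valuation.pos_iff.2 ht.ne_zero

theorem mem (ht : IsUniformizer A t) : t ∈ A :=
  (A.valuation_le_one_iff t).1 ht.valuation_lt_one.le

theorem congr (ht : IsUniformizer A t) (hst : A.valuation s = A.valuation t) :
    IsUniformizer A s where
  ne_zero := A.valuation.pos_iff.1 (hst ▸ ht.valuation_pos)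
  valuation_lt_one := hst ▸ ht.valuation_lt_one
  exists_zpow := hst ▸ ht.exists_zpow

theorem exists_pow (ht : IsUniformizer A t) (hz : z ≠ 0) (hzA : z ∈ A) :
    ∃ n : ℕ, A.valuation z = A.valuation t ^ n := by
  obtain ⟨n, hn⟩ := ht.exists_zpow z hz
  have hn0 : 0 ≤ n := by
    by_contra! hneg
    exact (one_lt_zpow_of_neg₀ ht.valuation_pos ht.valuation_lt_one hneg).not_ge
      (hn ▸ (A.valuation_le_one_iff z).2 hzA)
  lift n to ℕ using hn0
  exact ⟨n, by rw [hn, zpow_natCast]⟩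

theorem exists_pow_of_lt_one (ht : IsUniformizer A t) (hz : z ≠ 0) (hz1 : A.valuation z < 1) :
    ∃ n : ℕ, n ≠ 0 ∧ A.valuation z = A.valuation t ^ n := by
  obtain ⟨n, hn⟩ := ht.exists_pow hz ((A.valuation_le_one_iff z).1 hz1.le)
  refine ⟨n, ?_, hn⟩
  rintro rfl
  simp [hn] at hz1

theorem valuation_le (ht : IsUniformizer A t) (hz1 : A.valuation z < 1) :
    A.valuation z ≤ A.valuation t := by
  rcases eq_or_ne z 0 with rfl | hz
  · simp
  obtain ⟨n, hn0, hn⟩ := ht.exists_pow_of_lt_one hz hz1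
  exact hn ▸ pow_le_of_le_one zero_le ht.valuation_lt_one.le hn0

theorem valuation_eq (hs : IsUniformizer A s) (ht : IsUniformizer A t) :
    A.valuation s = A.valuation t :=
  (ht.valuation_le hs.valuation_lt_one).antisymm (hs.valuation_le ht.valuation_lt_one)

theorem maximalIdeal_eq (ht : IsUniformizer A t) :
    IsLocalRing.maximalIdeal A = Ideal.span {⟨t, ht.mem⟩} := by
  ext z
  rw [A.valuation_lt_one_iff, Ideal.mem_span_singleton']
  constructor
  · intro hz
    obtain ⟨a, ha⟩ := (A.valuation_le_iff _ _).1 (ht.valuation_le hz)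
    exact ⟨a, Subtype.ext ha⟩
  · rintro ⟨a, rfl⟩
    rw [MulMemClass.coe_mul, map_mul]
    exact (mul_le_of_le_one_left' (A.valuation_le_one a)).trans_lt ht.valuation_lt_one

theorem isDiscreteValuationRing (ht : IsUniformizer A t) : IsDiscreteValuationRing A := by
  let p : A := ⟨t, ht.mem⟩
  have hp0 : p ≠ 0 := fun h => ht.ne_zero (congrArg Subtype.val h)
  have hp : Prime p := (Ideal.span_singleton_prime hp0).1 <|
    ht.maximalIdeal_eq ▸ (IsLocalRing.maximalIdeal.isMaximal A).isPrime
  refine IsDiscreteValuationRing.ofHasUnitMulPowIrreducibleFactorization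
    ⟨p, hp.irreducible, fun {z} hz => ?_⟩
  obtain ⟨n, hn⟩ := ht.exists_pow (fun h => hz (Subtype.ext h)) z.2
  obtain ⟨u, hu⟩ := (A.valuation_eq_iff (z : K) (t ^ n)).1 (by rw [hn, map_pow])
  exact ⟨n, u, Subtype.ext (by simpa [mul_comm] using hu)⟩

theorem exists_mul_pow_lt {b c f : K} (ht : IsUniformizer A t) (hf : A.valuation f < 1)
    (hc : c ≠ 0) : ∃ N : ℕ, ∀ n ≥ N, A.valuation (b * f ^ n) < A.valuation c := by
  rcases eq_or_ne b 0 with rfl | hb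
  · exact ⟨0, fun n _ => by simpa [Valuation.pos_iff] using hc⟩
  obtain ⟨k, hk⟩ := ht.exists_zpow (b / c) (div_ne_zero hb hc)
  refine ⟨k.natAbs + 1, fun n hn => ?_⟩
  rw [← div_lt_one₀ (A.valuation.pos_iff.2 hc), ← map_div₀, mul_div_right_comm, map_mul,
    map_pow, hk]
  calc A.valuation t ^ k * A.valuation f ^ n
      ≤ A.valuation t ^ k * A.valuation t ^ n := by gcongr; exact ht.valuation_le hf
    _ = A.valuation t ^ (k + n) := by rw [zpow_add₀ ht.valuation_pos.ne', zpow_natCast]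
    _ < 1 := zpow_lt_one₀ ht.valuation_pos ht.valuation_lt_one (by omega)

theorem inv_notMem (ht : IsUniformizer A t) : t⁻¹ ∉ A := by
  rw [← A.valuation_le_one_iff, map_inv₀, not_le]
  exact (one_lt_inv₀ ht.valuation_pos).2 ht.valuation_lt_one

end IsUniformizer

theorem exists_isUniformizer (A : ValuationSubring K) [IsDiscreteValuationRing A] :
    ∃ t, IsUniformizer A t := by
  obtain ⟨p, hp⟩ := IsDiscreteValuationRing.exists_irreducible A
  have exists_pow (z : A) (hz : (z : K) ≠ 0) :
      ∃ n : ℕ, A.valuation (z : K) = A.valuation (p : K) ^ n := by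
    obtain ⟨n, u, hu⟩ := IsDiscreteValuationRing.eq_unit_mul_pow_irreducible
      (fun h => hz (congrArg Subtype.val h)) hp
    refine ⟨n, ?_⟩
    have hzu : (z : K) = (u : A) * (p : K) ^ n := by rw [hu]; simp
    rw [hzu, map_mul, A.valuation_unit, one_mul, map_pow]
  refine ⟨p, fun h => hp.ne_zero (Subtype.ext h),
    (A.valuation_lt_one_iff p).1 (by simpa using hp.not_isUnit), fun z hz => ?_⟩
  rcases A.mem_or_inv_mem z with h | h
  · obtain ⟨n, hn⟩ := exists_pow ⟨z, h⟩ hz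
    exact ⟨n, by rw [zpow_natCast, ← hn]⟩
  · obtain ⟨n, hn⟩ := exists_pow ⟨z⁻¹, h⟩ (inv_ne_zero hz)
    exact ⟨-n, by rw [zpow_neg, zpow_natCast, ← hn, map_inv₀, inv_inv]⟩

theorem valuation_inv_lt_one_iff : A.valuation z⁻¹ < 1 ↔ z = 0 ∨ z ∉ A := by
  rw [← A.mem_nonunits_iff, A.inv_mem_nonunits_iff]

end Uniformizers

section Extensions

variable {K L : Type*} [Field K] [Field L] [Algebra K L] {A : ValuationSubring K}
  {B : ValuationSubring L}

theorem valuation_algebraMap_le_iff (hB : B.comap (algebraMap K L) = A) (a b : K) :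
    B.valuation (algebraMap K L a) ≤ B.valuation (algebraMap K L b) ↔
      A.valuation a ≤ A.valuation b := by
  rcases eq_or_ne b 0 with rfl | hb
  · simp
  · have hb' : 0 < B.valuation (algebraMap K L b) := by simpa [Valuation.pos_iff] using hb
    rw [← div_le_one₀ hb', ← div_le_one₀ (A.valuation.pos_iff.2 hb), ← map_div₀, ← map_div₀,
      ← map_div₀, B.valuation_le_one_iff, A.valuation_le_one_iff, ← hB,
      ValuationSubring.mem_comap]

theorem valuation_algebraMap_lt_iff (hB : B.comap (algebraMap K L) = A) (a b : K) :
    B.valuation (algebraMap K L a) < B.valuation (algebraMap K L b) ↔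
      A.valuation a < A.valuation b := by
  rw [← not_le, ← not_le, valuation_algebraMap_le_iff hB]

theorem valuation_algebraMap_eq_iff (hB : B.comap (algebraMap K L) = A) (a b : K) :
    B.valuation (algebraMap K L a) = B.valuation (algebraMap K L b) ↔
      A.valuation a = A.valuation b := by
  rw [le_antisymm_iff, le_antisymm_iff, valuation_algebraMap_le_iff hB,
    valuation_algebraMap_le_iff hB]

theorem valuation_algebraMap_lt_one_iff (hB : B.comap (algebraMap K L) = A) (a : K) :
    B.valuation (algebraMap K L a) < 1 ↔ A.valuation a < 1 := by
  simpa using valuation_algebraMap_lt_iff hB a 1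

theorem algebraMap_mem_iff (hB : B.comap (algebraMap K L) = A) (a : K) :
    algebraMap K L a ∈ B ↔ a ∈ A := by
  rw [← hB, ValuationSubring.mem_comap]

theorem IsUniformizer.exists_zpow_algebraMap {t a : K} (ht : IsUniformizer A t)
    (hB : B.comap (algebraMap K L) = A) (ha : a ≠ 0) :
    ∃ n : ℤ, B.valuation (algebraMap K L a) = B.valuation (algebraMap K L t) ^ n := by
  obtain ⟨n, hn⟩ := ht.exists_zpow a ha
  exact ⟨n, by rw [← map_zpow₀, ← map_zpow₀, valuation_algebraMap_eq_iff hB, hn, map_zpow₀]⟩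

theorem exists_comap_algebraMap_eq (L : Type*) [Field L] [Algebra K L] (A : ValuationSubring K) :
    ∃ B : ValuationSubring L, B.comap (algebraMap K L) = A := by
  obtain ⟨B, hAB, hlocal⟩ :=
    IsLocalRing.exists_factor_valuationRing ((algebraMap K L).comp A.subtype)
  refine ⟨B, ValuationSubring.ext _ _ fun z => ?_⟩
  rw [ValuationSubring.mem_comap]
  refine ⟨fun hzB => by_contra fun hzA => ?_, fun hzA => hAB ⟨z, hzA⟩⟩
  have hz0 : z ≠ 0 := by rintro rfl; exact hzA A.zero_mem
  let w : A := ⟨z⁻¹, (A.mem_or_inv_mem z).resolve_left hzA⟩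
  have hw : IsUnit (((algebraMap K L).comp A.subtype).codRestrict B.toSubring hAB w) :=
    IsUnit.of_mul_eq_one ⟨algebraMap K L z, hzB⟩ <| Subtype.ext <| by
      change algebraMap K L z⁻¹ * algebraMap K L z = 1
      rw [← map_mul, inv_mul_cancel₀ hz0, map_one]
  have hzv : A.valuation z⁻¹ = 1 := (A.valuation_eq_one_iff w).1 (isUnit_of_map_unit _ w hw)
  exact (valuation_inv_lt_one_iff.2 (Or.inr hzA)).ne hzv

theorem exists_valuation_algebraMap_le [Algebra.IsAlgebraic K L] (B : ValuationSubring L) {z : L}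
    (hz : z ≠ 0) : ∃ c : K, c ≠ 0 ∧ B.valuation (algebraMap K L c) ≤ B.valuation z := by
  let A := B.comap (algebraMap K L)
  have hz_alg : IsAlgebraic A z⁻¹ :=
    (IsFractionRing.isAlgebraic_iff A K L).2 (Algebra.IsAlgebraic.isAlgebraic _)
  obtain ⟨c, hc, hcz⟩ := hz_alg.exists_integral_multiple
  have hczB : IsIntegral B (c • z⁻¹) :=
    hcz.map_of_comp_eq ((algebraMap K L).restrict A B fun _ h => h) (RingHom.id L) rfl
  obtain ⟨b, hb⟩ := IsIntegrallyClosed.isIntegral_iff.1 hczB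
  refine ⟨c, fun h => hc (Subtype.ext h), ?_⟩
  have hb' : (b : L) = algebraMap K L c / z := by
    rw [div_eq_mul_inv]
    exact hb.trans (Algebra.smul_def c z⁻¹)
  rw [← div_le_one₀ (B.valuation.pos_iff.2 hz), ← map_div₀, ← hb']
  exact B.valuation_le_one b

end Extensions

section RationalPlaces

variable (F : Type*) {K L : Type*} [Field F] [Field K] [Field L] [Algebra F K] [Algebra F L]
  [Algebra K L] {A : ValuationSubring K} {B : ValuationSubring L}

/-- The valuation ring `A` of `K` contains `F`, and `F` is its residue field. -/
structure IsRationalPlace (A : ValuationSubring K) : Prop where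
  algebraMap_mem : ∀ c : F, algebraMap F K c ∈ A
  exists_residue : ∀ z ∈ A, ∃ c : F, A.valuation (z - algebraMap F K c) < 1

variable {F} in
theorem IsRationalPlace.of_exists_sub_lt_one [IsScalarTower F K L] (hA : IsRationalPlace F A)
    (hB : B.comap (algebraMap K L) = A)
    (h : ∀ z ∈ B, ∃ a ∈ A, B.valuation (z - algebraMap K L a) < 1) : IsRationalPlace F B where
  algebraMap_mem c := by
    rw [IsScalarTower.algebraMap_apply F K L, algebraMap_mem_iff hB]
    exact hA.algebraMap_mem c
  exists_residue z hz := by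
    obtain ⟨a, haA, ha⟩ := h z hz
    obtain ⟨c, hc⟩ := hA.exists_residue a haA
    refine ⟨c, ?_⟩
    rw [← valuation_algebraMap_lt_one_iff hB, map_sub, ← IsScalarTower.algebraMap_apply] at hc
    simpa only [sub_add_sub_cancel] using Valuation.map_add_lt _ ha hc

variable (K) in
/-- `B` is an immediate extension of `B ∩ K`: the value group and the residue field do not grow. -/
def IsImmediate (B : ValuationSubring L) : Prop :=
  ∀ z : L, z ≠ 0 → ∃ a : K, B.valuation (z - algebraMap K L a) < B.valuation z

namespace IsImmediate

theorem isUniformizer_algebraMap {t : K} (h : IsImmediate K B)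
    (hB : B.comap (algebraMap K L) = A) (ht : IsUniformizer A t) :
    IsUniformizer B (algebraMap K L t) where
  ne_zero := (map_ne_zero _).2 ht.ne_zero
  valuation_lt_one := (valuation_algebraMap_lt_one_iff hB t).2 ht.valuation_lt_one
  exists_zpow z hz := by
    obtain ⟨a, ha⟩ := h z hz
    have haz : B.valuation (algebraMap K L a) = B.valuation z := by
      rw [Valuation.map_sub_swap] at ha
      simpa only [sub_add_cancel] using Valuation.map_add_eq_of_lt_right _ ha
    have ha0 : a ≠ 0 := by
      rintro rfl
      simp at ha
    exact haz ▸ ht.exists_zpow_algebraMap hB ha0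

variable {F} in
theorem isRationalPlace [IsScalarTower F K L] (h : IsImmediate K B)
    (hB : B.comap (algebraMap K L) = A) (hA : IsRationalPlace F A) : IsRationalPlace F B := by
  refine hA.of_exists_sub_lt_one hB fun z hz => ?_
  rcases eq_or_ne z 0 with rfl | hz0
  · exact ⟨0, A.zero_mem, by simp⟩
  obtain ⟨a, ha⟩ := h z hz0
  have ha1 := ha.trans_le ((B.valuation_le_one_iff z).2 hz)
  refine ⟨a, (algebraMap_mem_iff hB a).1 ?_, ha1⟩
  rw [← sub_sub_cancel z (algebraMap K L a)]
  exact B.sub_mem hz ((B.valuation_le_one_iff _).1 ha1.le)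

end IsImmediate

end RationalPlaces

section ArtinSchreier

variable {K L : Type*} [Field K] [Field L] [Algebra K L] {f : K} {y : L}

/-- `L = K(y)` is a separable quadratic extension of a field of characteristic two, given by the
equation `y² + y = f`. -/
structure IsArtinSchreierGenerator (f : K) (y : L) : Prop where
  two_eq_zero : (2 : K) = 0
  equation : y ^ 2 + y = algebraMap K L f
  exists_repr : ∀ z : L, ∃ a b : K, z = algebraMap K L a + algebraMap K L b * y
  notMem_range : y ∉ (algebraMap K L).range

theorem two_eq_zero_of_algebra (L : Type*) [Field L] [Algebra K L] (h : (2 : K) = 0) :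
    (2 : L) = 0 := by
  rw [← map_ofNat (algebraMap K L) 2, h, map_zero]

namespace IsArtinSchreierGenerator

theorem add (h : IsArtinSchreierGenerator f y) (g : K) :
    IsArtinSchreierGenerator (f - (g ^ 2 + g)) (y - algebraMap K L g) where
  two_eq_zero := h.two_eq_zero
  equation := by
    have := h.equation
    have := two_eq_zero_of_algebra L h.two_eq_zero
    simp only [map_sub, map_add, map_pow]
    grind
  exists_repr z := by
    obtain ⟨a, b, rfl⟩ := h.exists_repr z
    refine ⟨a + b * g, b, ?_⟩
    simp only [map_add, map_mul]
    ring
  notMem_range := by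
    rintro ⟨a, ha⟩
    exact h.notMem_range ⟨a + g, by rw [map_add, ha, sub_add_cancel]⟩

theorem add_one (h : IsArtinSchreierGenerator f y) : IsArtinSchreierGenerator f (y + 1) := by
  have hf : f - (1 ^ 2 + 1) = f := by linear_combination -h.two_eq_zero
  have hy : y - 1 = y + 1 := by linear_combination -two_eq_zero_of_algebra L h.two_eq_zero
  simpa only [hf, hy, map_one] using h.add 1

theorem ne_zero (h : IsArtinSchreierGenerator f y) : y ≠ 0 := by
  rintro rfl
  exact h.notMem_range ⟨0, map_zero _⟩

open Polynomial in
theorem monic_polynomial (f : K) : (X ^ 2 + X - C f : K[X]).Monic := by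
  monicity!

open Polynomial in
theorem isIntegral (h : IsArtinSchreierGenerator f y) : IsIntegral K y :=
  ⟨X ^ 2 + X - C f, monic_polynomial f, by simp [h.equation]⟩

open Polynomial in
theorem minpoly_eq (h : IsArtinSchreierGenerator f y) : minpoly K y = X ^ 2 + X - C f := by
  refine (eq_of_monic_of_dvd_of_natDegree_le (minpoly.monic h.isIntegral) (monic_polynomial f)
    (minpoly.dvd K y (by simp [h.equation])) ?_).symm
  have hdeg : (X ^ 2 + X - C f : K[X]).natDegree = 2 := by compute_degree!
  exact hdeg.trans_le ((minpoly.two_le_natDegree_iff h.isIntegral).2 h.notMem_range)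

open IntermediateField in
theorem adjoin_eq_top (h : IsArtinSchreierGenerator f y) : K⟮y⟯ = ⊤ := by
  refine top_unique fun z _ => ?_
  obtain ⟨a, b, rfl⟩ := h.exists_repr z
  exact add_mem (_root_.algebraMap_mem _ a)
    (mul_mem (_root_.algebraMap_mem _ b) (mem_adjoin_simple_self K y))

open IntermediateField in
theorem finrank_eq (h : IsArtinSchreierGenerator f y) : Module.finrank K L = 2 := by
  rw [← finrank_top', ← h.adjoin_eq_top, adjoin.finrank h.isIntegral, h.minpoly_eq]
  compute_degree!

theorem isQuadraticExtension (h : IsArtinSchreierGenerator f y) :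
    Algebra.IsQuadraticExtension K L where
  finrank_eq_two' := h.finrank_eq

theorem exists_conj (h : IsArtinSchreierGenerator f y) : ∃ σ : L ≃ₐ[K] L, σ y = y + 1 := by
  have := h.isQuadraticExtension
  refine isConjRoot_iff_exists_algEquiv.1 ?_
  rw [isConjRoot_def, h.minpoly_eq, h.add_one.minpoly_eq]

end IsArtinSchreierGenerator

end ArtinSchreier

section Split

variable {F K L : Type*} [Field F] [Field K] [Field L] [Algebra K L] {f : K} {y : L}
  {A : ValuationSubring K} {B : ValuationSubring L} {t : K}

/-- `B₁` and `B₂` are different, they are all the extensions of the valuation ring `A` of `K` to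
`L`, and both are immediate. -/
structure SplitsInto (A : ValuationSubring K) (B₁ B₂ : ValuationSubring L) : Prop where
  comap_left : B₁.comap (algebraMap K L) = A
  comap_right : B₂.comap (algebraMap K L) = A
  ne : B₁ ≠ B₂
  eq_or_eq : ∀ B : ValuationSubring L, B.comap (algebraMap K L) = A → B = B₁ ∨ B = B₂
  isImmediate_left : IsImmediate K B₁
  isImmediate_right : IsImmediate K B₂

namespace IsArtinSchreierGenerator

theorem valuation_eq_of_lt_one (h : IsArtinSchreierGenerator f y) (hy : B.valuation y < 1) :
    B.valuation y = B.valuation (algebraMap K L f) := by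
  have hy1 : B.valuation (1 + y) = 1 := by
    rw [Valuation.map_add_eq_of_lt_left] <;> simp [hy]
  rw [← h.equation, show y ^ 2 + y = y * (1 + y) by ring, map_mul, hy1, mul_one]

/-- The element of `K` is `f + f² + f⁴ + ⋯`, with `n` terms. -/
theorem exists_sub_algebraMap_eq_pow (h : IsArtinSchreierGenerator f y) (n : ℕ) :
    ∃ a : K, y - algebraMap K L a = y ^ 2 ^ n := by
  have h2 := two_eq_zero_of_algebra L h.two_eq_zero
  induction n with
  | zero => exact ⟨0, by simp⟩
  | succ n ih =>
    obtain ⟨a, ha⟩ := ih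
    refine ⟨f + a ^ 2, ?_⟩
    rw [pow_succ 2 n, pow_mul, ← ha, map_add, map_pow, ← h.equation]
    linear_combination (-y ^ 2 + y * algebraMap K L a - algebraMap K L a ^ 2) * h2

theorem exists_mul_sub_lt (h : IsArtinSchreierGenerator f y) (ht : IsUniformizer A t)
    (hf : A.valuation f < 1) {c : K} (hc : c ≠ 0) (b : K) :
    ∃ a : K, ∀ B : ValuationSubring L, B.comap (algebraMap K L) = A → B.valuation y < 1 →
      B.valuation (algebraMap K L b * (y - algebraMap K L a)) < B.valuation (algebraMap K L c) := by
  obtain ⟨N, hN⟩ := ht.exists_mul_pow_lt (b := b) hf hc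
  obtain ⟨a, ha⟩ := h.exists_sub_algebraMap_eq_pow N
  refine ⟨a, fun B hB hy => ?_⟩
  rw [ha, map_mul, map_pow, h.valuation_eq_of_lt_one hy, ← map_pow, ← map_mul, ← map_pow,
    ← map_mul, valuation_algebraMap_lt_iff hB]
  exact hN _ Nat.lt_two_pow_self.le

theorem isImmediate_of_lt_one (h : IsArtinSchreierGenerator f y) (ht : IsUniformizer A t)
    (hf : A.valuation f < 1) (hB : B.comap (algebraMap K L) = A) (hy : B.valuation y < 1) :
    IsImmediate K B := by
  intro z hz
  have := h.isQuadraticExtension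
  obtain ⟨c, hc, hcz⟩ := exists_valuation_algebraMap_le (K := K) B hz
  obtain ⟨a, b, rfl⟩ := h.exists_repr z
  obtain ⟨y', hy'⟩ := h.exists_mul_sub_lt ht hf hc b
  refine ⟨a + b * y', lt_of_lt_of_le ?_ hcz⟩
  convert hy' B hB hy using 2
  simp only [map_add, map_mul]
  ring

theorem eq_of_valuation_lt_one (h : IsArtinSchreierGenerator f y) (ht : IsUniformizer A t)
    (hf : A.valuation f < 1) {B' : ValuationSubring L} (hB : B.comap (algebraMap K L) = A)
    (hB' : B'.comap (algebraMap K L) = A) (hy : B.valuation y < 1) (hy' : B'.valuation y < 1) :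
    B = B' := by
  ext z
  obtain ⟨a, b, rfl⟩ := h.exists_repr z
  obtain ⟨w, hw⟩ := h.exists_mul_sub_lt ht hf one_ne_zero b
  have mem_iff (C : ValuationSubring L) (hC : C.comap (algebraMap K L) = A)
      (hyC : C.valuation y < 1) :
      algebraMap K L a + algebraMap K L b * y ∈ C ↔ a + b * w ∈ A := by
    have hsub : algebraMap K L b * (y - algebraMap K L w) ∈ C :=
      (C.valuation_le_one_iff _).1 (by simpa using (hw C hC hyC).le)
    have hadd : algebraMap K L a + algebraMap K L b * y =
        algebraMap K L (a + b * w) + algebraMap K L b * (y - algebraMap K L w) := by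
      simp only [map_add, map_mul]
      ring
    rw [← algebraMap_mem_iff hC, hadd]
    exact add_mem_cancel_right hsub
  rw [mem_iff B hB hy, mem_iff B' hB' hy']

theorem lt_one_or_add_one_lt_one (h : IsArtinSchreierGenerator f y) (hf : A.valuation f < 1)
    (hB : B.comap (algebraMap K L) = A) : B.valuation y < 1 ∨ B.valuation (y + 1) < 1 := by
  have hmul : B.valuation y * B.valuation (y + 1) < 1 := by
    rwa [← map_mul, show y * (y + 1) = y ^ 2 + y by ring, h.equation,
      valuation_algebraMap_lt_one_iff hB]
  by_contra! hle
  exact (one_le_mul_of_one_le_of_one_le hle.1 hle.2).not_gt hmul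

end IsArtinSchreierGenerator

theorem comap_comap_algEquiv (σ : L ≃ₐ[K] L) (B : ValuationSubring L) :
    (B.comap (σ : L →+* L)).comap (algebraMap K L) = B.comap (algebraMap K L) := by
  rw [ValuationSubring.comap_comap]
  congr 1
  ext a
  simp

theorem valuation_comap_lt_one_iff (σ : L ≃ₐ[K] L) (B : ValuationSubring L) (z : L) :
    (B.comap (σ : L →+* L)).valuation z < 1 ↔ B.valuation (σ z) < 1 := by
  let := (σ : L →+* L).toAlgebra
  exact (valuation_algebraMap_lt_one_iff (K := L) (B := B) rfl z).symm

namespace IsArtinSchreierGenerator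

theorem exists_splitsInto (h : IsArtinSchreierGenerator f y) (ht : IsUniformizer A t)
    (hf : A.valuation f < 1) : ∃ B₁ B₂ : ValuationSubring L,
      SplitsInto A B₁ B₂ ∧ B₁.valuation y < 1 ∧ B₂.valuation (y + 1) < 1 := by
  obtain ⟨σ, hσ⟩ := h.exists_conj
  have hσ' : σ (y + 1) = y := by
    rw [map_add, hσ, map_one]
    linear_combination two_eq_zero_of_algebra L h.two_eq_zero
  obtain ⟨B₁, hB₁, hy₁⟩ : ∃ B₁ : ValuationSubring L,
      B₁.comap (algebraMap K L) = A ∧ B₁.valuation y < 1 := by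
    obtain ⟨B, hB⟩ := exists_comap_algebraMap_eq L A
    rcases h.lt_one_or_add_one_lt_one hf hB with hy | hy
    · exact ⟨B, hB, hy⟩
    · exact ⟨_, (comap_comap_algEquiv σ B).trans hB,
        (valuation_comap_lt_one_iff σ B y).2 (hσ ▸ hy)⟩
  have hB₂ := (comap_comap_algEquiv σ B₁).trans hB₁
  have hy₂ := (valuation_comap_lt_one_iff σ B₁ (y + 1)).2 (hσ'.symm ▸ hy₁)
  refine ⟨B₁, B₁.comap (σ : L →+* L), ⟨hB₁, hB₂, fun heq => ?_, fun B hB => ?_,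
    h.isImmediate_of_lt_one ht hf hB₁ hy₁, h.add_one.isImmediate_of_lt_one ht hf hB₂ hy₂⟩,
    hy₁, hy₂⟩
  · rw [← heq] at hy₂
    simpa using Valuation.map_sub_lt _ hy₂ hy₁
  · rcases h.lt_one_or_add_one_lt_one hf hB with hy | hy
    · exact Or.inl (h.eq_of_valuation_lt_one ht hf hB hB₁ hy hy₁)
    · exact Or.inr (h.add_one.eq_of_valuation_lt_one ht hf hB hB₂ hy hy₂)

end IsArtinSchreierGenerator

open Polynomial in
theorem exists_sq_add_self_eq [IsAlgClosed F] (e : F) : ∃ c : F, c ^ 2 + c = e := by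
  have hdeg : (X ^ 2 + X - C e).degree = 2 := by compute_degree!
  obtain ⟨c, hc⟩ := IsAlgClosed.exists_root (X ^ 2 + X - C e) (by rw [hdeg]; decide)
  exact ⟨c, by simpa [IsRoot, sub_eq_zero] using hc⟩

theorem IsArtinSchreierGenerator.exists_splitsInto_of_sub_mem [IsAlgClosed F] [Algebra F K]
    [Algebra F L] [IsScalarTower F K L] {g : K} (h : IsArtinSchreierGenerator f y)
    (ht : IsUniformizer A t) (hA : IsRationalPlace F A) (hg : f - (g ^ 2 + g) ∈ A) :
    ∃ (c : F) (B₁ B₂ : ValuationSubring L), SplitsInto A B₁ B₂ ∧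
      B₁.valuation (y - algebraMap K L g - algebraMap F L c) < 1 ∧
      B₂.valuation (y - algebraMap K L g - algebraMap F L (c + 1)) < 1 := by
  have h2 := h.two_eq_zero
  have h2L := two_eq_zero_of_algebra L h2
  obtain ⟨e, he⟩ := hA.exists_residue _ hg
  obtain ⟨c, rfl⟩ := exists_sq_add_self_eq e
  have hf : A.valuation (f - ((g + algebraMap F K c) ^ 2 + (g + algebraMap F K c))) < 1 := by
    convert he using 2
    rw [map_add, map_pow]
    grind
  obtain ⟨B₁, B₂, hsplit, hy₁, hy₂⟩ := (h.add (g + algebraMap F K c)).exists_splitsInto ht hf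
  rw [map_add (algebraMap K L), ← IsScalarTower.algebraMap_apply] at hy₁ hy₂
  refine ⟨c, B₁, B₂, hsplit, by rwa [sub_sub], ?_⟩
  rw [map_add, map_one]
  convert hy₂ using 2
  grind

theorem IsArtinSchreierGenerator.exists_splitsInto_of_mem [IsAlgClosed F] [Algebra F K]
    [Algebra F L] [IsScalarTower F K L] (h : IsArtinSchreierGenerator f y)
    (ht : IsUniformizer A t) (hA : IsRationalPlace F A) (hf : f ∈ A) :
    ∃ (c : F) (B₁ B₂ : ValuationSubring L), SplitsInto A B₁ B₂ ∧
      B₁.valuation (y - algebraMap F L c) < 1 ∧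
      B₂.valuation (y - algebraMap F L (c + 1)) < 1 := by
  simpa using h.exists_splitsInto_of_sub_mem ht hA (g := 0) (by simpa using hf)

end Split

section Ramified

variable {F K L : Type*} [Field F] [Field K] [Field L] [Algebra K L] {f g : K} {y z : L}
  {A : ValuationSubring K} {B : ValuationSubring L}

theorem valuation_eq_of_sub_mem {z w : K} (hw : w ∉ A) (hzw : z - w ∈ A) :
    A.valuation z = A.valuation w := by
  have hw1 : 1 < A.valuation w := by rwa [← not_le, A.valuation_le_one_iff]
  rw [← sub_add_cancel z w]
  exact Valuation.map_add_eq_of_lt_right _ (((A.valuation_le_one_iff _).2 hzw).trans_lt hw1)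

theorem valuation_sq_add_self {z : K} (hz : z ∉ A) :
    A.valuation (z ^ 2 + z) = A.valuation z ^ 2 := by
  have hz1 : 1 < A.valuation z := by rwa [← not_le, A.valuation_le_one_iff]
  rw [Valuation.map_add_eq_of_lt_left, map_pow]
  rw [map_pow]
  exact lt_self_pow₀ hz1 one_lt_two

theorem valuation_sq_eq_of_sub_mem (hB : B.comap (algebraMap K L) = A) (hg : g ∉ A)
    (hz : z ^ 2 + z - algebraMap K L g ∈ B) :
    B.valuation z ^ 2 = B.valuation (algebraMap K L g) := by
  rw [← algebraMap_mem_iff hB] at hg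
  have hzB : z ∉ B := fun h => hg <| by
    rw [← sub_sub_cancel (z ^ 2 + z) (algebraMap K L g)]
    exact B.sub_mem (B.add_mem _ _ (pow_mem h 2) h) hz
  rw [← valuation_sq_add_self hzB, valuation_eq_of_sub_mem hg hz]

/-- `B` is the only extension of the valuation ring `A` of `K` to `L`, and its ramification index
is two. -/
structure RamifiesInto (A : ValuationSubring K) (B : ValuationSubring L) : Prop where
  comap_eq : B.comap (algebraMap K L) = A
  eq_of_comap_eq : ∀ B' : ValuationSubring L, B'.comap (algebraMap K L) = A → B' = B
  exists_isUniformizer : ∃ t s, IsUniformizer A t ∧ IsUniformizer B s ∧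
    B.valuation (algebraMap K L t) = B.valuation s ^ 2

section EvenValuations

variable (hf : IsUniformizer A f⁻¹) (hB : B.comap (algebraMap K L) = A)
  (hy : B.valuation y ^ 2 = B.valuation (algebraMap K L f))

include hf hB hy

theorem one_lt_valuation_of_sq_eq : 1 < B.valuation y := by
  have hfB : algebraMap K L f ∉ B := by
    rw [algebraMap_mem_iff hB]
    simpa only [inv_inv] using hf.inv_notMem
  rwa [← B.valuation_le_one_iff, ← hy, pow_le_one_iff_of_nonneg zero_le two_ne_zero, not_le] at hfB

theorem exists_valuation_algebraMap_eq_zpow {a : K} (ha : a ≠ 0) :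
    ∃ n : ℤ, B.valuation (algebraMap K L a) = B.valuation y ^ (2 * n) := by
  obtain ⟨n, hn⟩ := hf.exists_zpow_algebraMap hB ha
  refine ⟨-n, ?_⟩
  rw [hn, map_inv₀, map_inv₀, ← hy, zpow_mul, zpow_neg, inv_zpow]
  rfl

theorem exists_valuation_algebraMap_mul_eq_zpow {b : K} (hb : b ≠ 0) :
    ∃ n : ℤ, B.valuation (algebraMap K L b * y) = B.valuation y ^ (2 * n + 1) := by
  obtain ⟨n, hn⟩ := exists_valuation_algebraMap_eq_zpow hf hB hy hb
  have hy0 := zero_lt_one.trans (one_lt_valuation_of_sq_eq hf hB hy)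
  exact ⟨n, by rw [map_mul, hn, zpow_add_one₀ hy0.ne']⟩

theorem valuation_algebraMap_ne_algebraMap_mul {a : K} (ha : a ≠ 0) (b : K) :
    B.valuation (algebraMap K L a) ≠ B.valuation (algebraMap K L b * y) := by
  rcases eq_or_ne b 0 with rfl | hb
  · simpa using ha
  have hy1 := one_lt_valuation_of_sq_eq hf hB hy
  obtain ⟨n, hn⟩ := exists_valuation_algebraMap_eq_zpow hf hB hy ha
  obtain ⟨m, hm⟩ := exists_valuation_algebraMap_mul_eq_zpow hf hB hy hb
  rw [hn, hm, (zpow_right_injective₀ (zero_lt_one.trans hy1) hy1.ne').ne_iff]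
  omega

theorem valuation_add_mul_eq_max (a b : K) :
    B.valuation (algebraMap K L a + algebraMap K L b * y) =
      max (B.valuation (algebraMap K L a)) (B.valuation (algebraMap K L b * y)) := by
  rcases eq_or_ne a 0 with rfl | ha
  · simp
  · exact Valuation.map_add_of_distinct_val _
      (valuation_algebraMap_ne_algebraMap_mul hf hB hy ha b)

theorem exists_valuation_eq_zpow {a b : K} (hab : a ≠ 0 ∨ b ≠ 0) :
    ∃ n : ℤ, B.valuation (algebraMap K L a + algebraMap K L b * y) = B.valuation y ^ n := by
  rcases eq_or_ne b 0 with rfl | hb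
  · obtain ⟨n, hn⟩ := exists_valuation_algebraMap_eq_zpow hf hB hy (hab.resolve_right (· rfl))
    exact ⟨2 * n, by rw [← hn, map_zero, zero_mul, add_zero]⟩
  obtain ⟨m, hm⟩ := exists_valuation_algebraMap_mul_eq_zpow hf hB hy hb
  rcases eq_or_ne a 0 with rfl | ha
  · exact ⟨2 * m + 1, by rw [← hm, map_zero, zero_add]⟩
  obtain ⟨n, hn⟩ := exists_valuation_algebraMap_eq_zpow hf hB hy ha
  rw [valuation_add_mul_eq_max hf hB hy]
  rcases max_choice (B.valuation (algebraMap K L a)) (B.valuation (algebraMap K L b * y))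
    with h | h
  · exact ⟨2 * n, h.trans hn⟩
  · exact ⟨2 * m + 1, h.trans hm⟩

theorem algebraMap_add_mul_mem_iff (a b : K) :
    algebraMap K L a + algebraMap K L b * y ∈ B ↔
      a ∈ A ∧ B.valuation (algebraMap K L b * y) < 1 := by
  have hne : B.valuation (algebraMap K L b * y) ≠ 1 := by
    simpa using (valuation_algebraMap_ne_algebraMap_mul hf hB hy one_ne_zero b).symm
  rw [← B.valuation_le_one_iff, valuation_add_mul_eq_max hf hB hy, max_le_iff,
    B.valuation_le_one_iff, algebraMap_mem_iff hB, hne.le_iff_lt]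

end EvenValuations

namespace IsArtinSchreierGenerator

variable (h : IsArtinSchreierGenerator f y) (hf : IsUniformizer A f⁻¹)
  (hB : B.comap (algebraMap K L) = A)

include h hf hB

theorem valuation_sq_eq : B.valuation y ^ 2 = B.valuation (algebraMap K L f) :=
  valuation_sq_eq_of_sub_mem hB (by simpa only [inv_inv] using hf.inv_notMem)
    (by simpa only [h.equation, sub_self] using B.zero_mem)

theorem isUniformizer_inv : IsUniformizer B y⁻¹ where
  ne_zero := inv_ne_zero h.ne_zero
  valuation_lt_one := by
    rw [map_inv₀]
    exact inv_lt_one_of_one_lt₀ (one_lt_valuation_of_sq_eq hf hB (h.valuation_sq_eq hf hB))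
  exists_zpow z hz := by
    obtain ⟨a, b, rfl⟩ := h.exists_repr z
    have hab : a ≠ 0 ∨ b ≠ 0 := by
      by_contra! hab
      simp [hab] at hz
    obtain ⟨n, hn⟩ := exists_valuation_eq_zpow hf hB (h.valuation_sq_eq hf hB) hab
    exact ⟨-n, by rw [hn, map_inv₀, inv_zpow', neg_neg]⟩

theorem isUniformizer_inv_of_sub_mem (hg : IsUniformizer A g⁻¹)
    (hz : z ^ 2 + z - algebraMap K L g ∈ B) : IsUniformizer B z⁻¹ := by
  have hgA : g ∉ A := by simpa only [inv_inv] using hg.inv_notMem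
  have hgf : A.valuation g = A.valuation f := by simpa using hg.valuation_eq hf
  have hzy : B.valuation z = B.valuation y := by
    rw [← pow_left_inj₀ zero_le zero_le two_ne_zero, valuation_sq_eq_of_sub_mem hB hgA hz,
      h.valuation_sq_eq hf hB, valuation_algebraMap_eq_iff hB, hgf]
  exact (h.isUniformizer_inv hf hB).congr (by rw [map_inv₀, map_inv₀, hzy])

theorem isRationalPlace_of_ramified [Algebra F K] [Algebra F L] [IsScalarTower F K L]
    (hA : IsRationalPlace F A) : IsRationalPlace F B := by
  refine hA.of_exists_sub_lt_one hB fun z hz => ?_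
  obtain ⟨a, b, rfl⟩ := h.exists_repr z
  obtain ⟨ha, hb⟩ := (algebraMap_add_mul_mem_iff hf hB (h.valuation_sq_eq hf hB) a b).1 hz
  exact ⟨a, ha, by rwa [add_sub_cancel_left]⟩

theorem mem_iff_of_ramified (a b : K) :
    algebraMap K L a + algebraMap K L b * y ∈ B ↔ a ∈ A ∧ A.valuation (b ^ 2 * f) < 1 := by
  have hy := h.valuation_sq_eq hf hB
  rw [algebraMap_add_mul_mem_iff hf hB hy, ← valuation_algebraMap_lt_one_iff hB, map_mul, map_mul,
    map_mul, ← hy, map_pow, map_pow, ← mul_pow, pow_lt_one_iff_of_nonneg zero_le two_ne_zero]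

theorem eq_of_ramified {B' : ValuationSubring L} (hB' : B'.comap (algebraMap K L) = A) :
    B = B' := by
  ext z
  obtain ⟨a, b, rfl⟩ := h.exists_repr z
  rw [h.mem_iff_of_ramified hf hB, h.mem_iff_of_ramified hf hB']

omit hB in
theorem exists_ramifiesInto : ∃ B : ValuationSubring L, RamifiesInto A B := by
  obtain ⟨B, hB⟩ := exists_comap_algebraMap_eq L A
  refine ⟨B, hB, fun B' hB' => h.eq_of_ramified hf hB' hB, _, _, hf, h.isUniformizer_inv hf hB, ?_⟩
  rw [map_inv₀, map_inv₀, map_inv₀, inv_pow, h.valuation_sq_eq hf hB]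

end IsArtinSchreierGenerator

end Ramified

section PoleChains

variable {F K L : Type*} [Field F] [Field K] [Field L] [Algebra F K] [Algebra F L] [Algebra K L]
  [IsScalarTower F K L] {A : ValuationSubring K} {B : ValuationSubring L} {f r x y z : K}
  {m : ℕ} {ω : F}

theorem IsUniformizer.inv_congr (hy : IsUniformizer A y⁻¹) (hxy : x - y ∈ A) :
    IsUniformizer A x⁻¹ := by
  have hyA : y ∉ A := by simpa only [inv_inv] using hy.inv_notMem
  exact hy.congr (by rw [map_inv₀, map_inv₀, valuation_eq_of_sub_mem hyA hxy])

theorem mem_of_sq_add_self_mem (hz : z ^ 2 + z ∈ A) : z ∈ A := by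
  by_contra hzA
  have hz1 : 1 < A.valuation z := by rwa [← not_le, A.valuation_le_one_iff]
  rw [← A.valuation_le_one_iff, valuation_sq_add_self hzA] at hz
  exact (one_lt_pow₀ hz1 two_ne_zero).not_ge hz

theorem valuation_algebraMap_eq_one (hA : ∀ c : F, algebraMap F K c ∈ A) {c : F} (hc : c ≠ 0) :
    A.valuation (algebraMap F K c) = 1 := by
  have hmem := hA c⁻¹
  rw [map_inv₀, ← A.valuation_le_one_iff, map_inv₀,
    inv_le_one₀ (A.valuation.pos_iff.2 ((map_ne_zero _).2 hc))] at hmem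
  exact ((A.valuation_le_one_iff _).2 (hA c)).antisymm hmem

theorem algebraMap_mul_mem_iff (hA : ∀ c : F, algebraMap F K c ∈ A) {c : F} (hc : c ≠ 0) :
    algebraMap F K c * z ∈ A ↔ z ∈ A := by
  rw [← A.valuation_le_one_iff, map_mul, valuation_algebraMap_eq_one hA hc, one_mul,
    A.valuation_le_one_iff]

theorem ne_zero_of_sq_add_self_add_one (hω : ω ^ 2 + ω + 1 = 0) : ω ≠ 0 := by
  rintro rfl
  simp at hω

theorem algebraMap_sq_add_self_add_one (K : Type*) [Field K] [Algebra F K]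
    (hω : ω ^ 2 + ω + 1 = 0) : algebraMap F K ω ^ 2 + algebraMap F K ω + 1 = 0 := by
  simpa only [map_add, map_pow, map_one, map_zero] using congrArg (algebraMap F K) hω

/-- A function `y` whose pole at `A` is reduced to a simple pole in `m` steps
`y ≡ ω (r² + r)` modulo functions regular at `A`, where `ω` is a primitive cube root of unity.
The root `ω` may change from step to step. -/
inductive PoleChain (F : Type*) {K : Type*} [Field F] [Field K] [Algebra F K]
    (A : ValuationSubring K) : ℕ → K → Prop
  | simple {y : K} : IsUniformizer A y⁻¹ → PoleChain F A 0 y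
  | step {m : ℕ} {y r : K} {ω : F} : ω ^ 2 + ω + 1 = 0 → PoleChain F A m r →
      y - algebraMap F K ω * (r ^ 2 + r) ∈ A → PoleChain F A (m + 1) y

namespace PoleChain

theorem congr (hy : PoleChain F A m y) (hxy : x - y ∈ A) : PoleChain F A m x := by
  cases hy with
  | simple hy => exact .simple (hy.inv_congr hxy)
  | step hω hr hyr => exact .step hω hr (by simpa using A.add_mem _ _ hxy hyr)

theorem notMem (hA : ∀ c : F, algebraMap F K c ∈ A) (hy : PoleChain F A m y) : y ∉ A := by
  induction hy with
  | simple hy => simpa only [inv_inv] using hy.inv_notMem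
  | step hω _ hyr ih =>
    intro hyA
    have hrA := A.sub_mem hyA hyr
    rw [sub_sub_cancel] at hrA
    exact ih <| mem_of_sq_add_self_mem <|
      (algebraMap_mul_mem_iff hA (ne_zero_of_sq_add_self_add_one hω)).1 hrA

theorem map_of_isImmediate (hy : PoleChain F A m y) (hB : B.comap (algebraMap K L) = A)
    (himm : IsImmediate K B) : PoleChain F B m (algebraMap K L y) := by
  induction hy with
  | simple hy => exact .simple (by rw [← map_inv₀]; exact himm.isUniformizer_algebraMap hB hy)
  | step hω _ hyr ih =>
    refine .step hω ih ?_
    rw [← algebraMap_mem_iff hB] at hyr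
    simpa [← IsScalarTower.algebraMap_apply] using hyr

theorem exists_isUniformizer_inv (h2 : (2 : K) = 0) (hy : PoleChain F A m y) :
    ∃ g, IsUniformizer A (y - (g ^ 2 + g))⁻¹ := by
  induction hy with
  | simple hy => exact ⟨0, by simpa using hy⟩
  | @step _ y r ω hω _ hyr ih =>
    obtain ⟨g, hg⟩ := ih
    have hωK := algebraMap_sq_add_self_add_one K hω
    refine ⟨g + algebraMap F K ω ^ 2 * r, hg.inv_congr ?_⟩
    convert hyr using 1
    grind

theorem exists_sub_mem_of_ramified {r s : L} (h2 : (2 : L) = 0)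
    (hF : ∀ c : F, algebraMap F L c ∈ B) (hω : ω ^ 2 + ω + 1 = 0)
    (hs : s ^ 2 + s - algebraMap F L ω * (r ^ 2 + r) ∈ B) :
    ∃ t, t ^ 2 + t - r ∈ B ∧ s - ((algebraMap F L ω * t) ^ 2 + algebraMap F L ω * t) ∈ B := by
  have hωL := algebraMap_sq_add_self_add_one L hω
  refine ⟨s + algebraMap F L ω ^ 2 * r, ?_, ?_⟩
  · convert hs using 1
    grind
  · convert B.mul_mem _ _ (pow_mem (hF ω) 2) hs using 1
    grind

section OverRamified

variable {w : L} (h : IsArtinSchreierGenerator f w) (hf : IsUniformizer A f⁻¹)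
  (hB : B.comap (algebraMap K L) = A) (hF : ∀ c : F, algebraMap F L c ∈ B)

include h hB hF

theorem exists_sub_mem_of_step {r x : K} {s : L} (hω : ω ^ 2 + ω + 1 = 0)
    (hx : x - algebraMap F K ω * (r ^ 2 + r) ∈ A) (hs : s ^ 2 + s - algebraMap K L x ∈ B) :
    ∃ t, t ^ 2 + t - algebraMap K L r ∈ B ∧
      s - ((algebraMap F L ω * t) ^ 2 + algebraMap F L ω * t) ∈ B := by
  rw [← algebraMap_mem_iff hB, map_sub, map_mul, map_add, map_pow,
    ← IsScalarTower.algebraMap_apply] at hx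
  refine exists_sub_mem_of_ramified (two_eq_zero_of_algebra L h.two_eq_zero) hF hω ?_
  rw [← sub_add_sub_cancel]
  exact B.add_mem _ _ hs hx

include hf

theorem mul_of_ramified {s : L} (hx : PoleChain F A m x) (hs : s ^ 2 + s - algebraMap K L x ∈ B)
    (hω : ω ^ 2 + ω + 1 = 0) : PoleChain F B m (algebraMap F L ω * s) := by
  induction hx generalizing s ω with
  | simple hx =>
    refine .simple ((h.isUniformizer_inv_of_sub_mem hf hB hx hs).congr ?_)
    rw [mul_inv, map_mul, map_inv₀,
      valuation_algebraMap_eq_one hF (ne_zero_of_sq_add_self_add_one hω), inv_one, one_mul]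
  | step hω' _ hx ih =>
    obtain ⟨t, ht, hst⟩ := exists_sub_mem_of_step h hB hF hω' hx hs
    refine .step hω (ih ht hω') ?_
    rw [← mul_sub]
    exact B.mul_mem _ _ (hF ω) hst

theorem exists_of_ramified {s : L} (hx : PoleChain F A (m + 1) x)
    (hs : s ^ 2 + s - algebraMap K L x ∈ B) :
    ∃ g, PoleChain F B m g ∧ s - (g ^ 2 + g) ∈ B := by
  cases hx with
  | step hω hr hx =>
    obtain ⟨t, ht, hst⟩ := exists_sub_mem_of_step h hB hF hω hx hs
    exact ⟨_, hr.mul_of_ramified h hf hB hF ht hω, hst⟩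

end OverRamified

end PoleChain

end PoleChains

section PlaceTypes

variable {F K L : Type*} [Field F] [Field K] [Field L] [Algebra F K] [Algebra F L] [Algebra K L]
  [IsScalarTower F K L] {A : ValuationSubring K} {B : ValuationSubring L} {m : ℕ}

/-- The types of points of `C_i`. The right-hand side `x_i + 1 + 1 / x_i` of the next equation of
the tower has a pole that makes the point ramified (`ramified`), or a pole that is removed by
adding some `g ^ 2 + g` (`unramifiedPole`), or `x_i` takes the value `1` (`one`), a primitive cube
root of unity (`cubeRoot`), or any other value in `F` except `0` (`generic`). Here `m` is the number
of steps that reduce the pole of a certain function of `x_i`, given in `HasPlaceType`, to a simple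
one. -/
inductive PlaceType
  | ramified (m : ℕ)
  | unramifiedPole (m : ℕ)
  | one (m : ℕ)
  | cubeRoot (m : ℕ)
  | generic

/-- The coordinate `x` has type `τ` at the place `A`. -/
def HasPlaceType (F : Type*) {K : Type*} [Field F] [Field K] [Algebra F K]
    (A : ValuationSubring K) (x : K) : PlaceType → Prop
  | .ramified m => PoleChain F A m (x + 1 + 1 / x)
  | .unramifiedPole m => ∃ g, PoleChain F A m g ∧ x - (g ^ 2 + g) ∈ A
  | .one m => PoleChain F A m (1 / (x + 1))
  | .cubeRoot m => ∃ ω : F, ω ^ 2 + ω + 1 = 0 ∧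
      PoleChain F A m (algebraMap F K ω / (x + algebraMap F K ω))
  | .generic => A.valuation x = 1 ∧ A.valuation (x + 1) = 1 ∧ A.valuation (x ^ 2 + x + 1) = 1

/-- The place `A` of `K` splits in `L` into two places at which `y` has the types `τ₁` and
`τ₂`. -/
def SplitsWithTypes (F : Type*) {K L : Type*} [Field F] [Field K] [Field L] [Algebra F L]
    [Algebra K L] (A : ValuationSubring K) (y : L) (τ₁ τ₂ : PlaceType) : Prop :=
  ∃ B₁ B₂ : ValuationSubring L,
    SplitsInto A B₁ B₂ ∧ HasPlaceType F B₁ y τ₁ ∧ HasPlaceType F B₂ y τ₂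

/-- The type of the coordinate at the place over a place of type `ramified m`. -/
def PlaceType.aboveRamified : ℕ → PlaceType
  | 0 => .ramified 0
  | m + 1 => .unramifiedPole m

theorem add_one_add_one_div_sub_mem {x : K} (hx : x ∉ A) : x + 1 + 1 / x - x ∈ A := by
  have hinv : 1 / x ∈ A := by
    rw [one_div, ← A.valuation_le_one_iff]
    exact (valuation_inv_lt_one_iff.2 (Or.inr hx)).le
  convert A.add_mem _ _ A.one_mem hinv using 1
  ring

theorem PoleChain.hasPlaceType_ramified (hA : ∀ c : F, algebraMap F K c ∈ A) {x : K}
    (hx : PoleChain F A m x) : HasPlaceType F A x (.ramified m) :=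
  hx.congr (add_one_add_one_div_sub_mem (hx.notMem hA))

theorem HasPlaceType.notMem_of_unramifiedPole (hA : ∀ c : F, algebraMap F K c ∈ A) {x : K}
    (hx : HasPlaceType F A x (.unramifiedPole m)) : x ∉ A := by
  obtain ⟨g, hg, hxg⟩ := hx
  intro hxA
  have hgA := A.sub_mem hxA hxg
  rw [sub_sub_cancel] at hgA
  exact hg.notMem hA (mem_of_sq_add_self_mem hgA)

theorem valuation_add_one_eq_one {z : K} (hz : A.valuation z < 1) : A.valuation (z + 1) = 1 := by
  rw [Valuation.map_add_eq_of_lt_right, map_one]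
  rwa [map_one]

theorem ne_zero_of_valuation_eq_one {z : K} (hz : A.valuation z = 1) : z ≠ 0 :=
  A.valuation.pos_iff.1 (hz ▸ zero_lt_one)

theorem one_div_mem_of_valuation_eq_one {z : K} (hz : A.valuation z = 1) : 1 / z ∈ A := by
  rw [← A.valuation_le_one_iff, map_div₀, hz, map_one, div_one]

section PoleInEquation

variable {x : K} {y : L} (h : IsArtinSchreierGenerator (x + 1 + 1 / x) y)

include h

theorem exists_ramifiesInto_hasPlaceType (hA : IsRationalPlace F A)
    (hx : HasPlaceType F A x (.ramified m)) :
    ∃ B : ValuationSubring L, RamifiesInto A B ∧ IsRationalPlace F B ∧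
      HasPlaceType F B y (.aboveRamified m) := by
  obtain ⟨g, hg⟩ := PoleChain.exists_isUniformizer_inv h.two_eq_zero hx
  have hgen := h.add g
  obtain ⟨B, hB⟩ := hgen.exists_ramifiesInto hg
  have hBF := hgen.isRationalPlace_of_ramified hg hB.comap_eq hA
  have hy : y ^ 2 + y - algebraMap K L (x + 1 + 1 / x) ∈ B := by
    rw [h.equation, sub_self]
    exact B.zero_mem
  refine ⟨B, hB, hBF, ?_⟩
  cases m with
  | zero =>
    cases hx with
    | simple hx =>
      exact PoleChain.hasPlaceType_ramified hBF.algebraMap_mem <|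
        .simple (hgen.isUniformizer_inv_of_sub_mem hg hB.comap_eq hx hy)
  | succ m => exact PoleChain.exists_of_ramified hgen hg hB.comap_eq hBF.algebraMap_mem hx hy

theorem splitsWithTypes_of_unramifiedPole [IsAlgClosed F] {t : K} (ht : IsUniformizer A t)
    (hA : IsRationalPlace F A) (hx : HasPlaceType F A x (.unramifiedPole m)) :
    SplitsWithTypes F A y (.ramified m) (.ramified m) := by
  have hxA := hx.notMem_of_unramifiedPole hA.algebraMap_mem
  obtain ⟨g, hg, hgx⟩ := hx
  have hfg : x + 1 + 1 / x - (g ^ 2 + g) ∈ A := by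
    rw [← sub_add_sub_cancel]
    exact A.add_mem _ _ (add_one_add_one_div_sub_mem hxA) hgx
  obtain ⟨c, B₁, B₂, hsplit, hy₁, hy₂⟩ := h.exists_splitsInto_of_sub_mem ht hA hfg
  have hasPlaceType (B : ValuationSubring L) (c : F) (hB : B.comap (algebraMap K L) = A)
      (himm : IsImmediate K B)
      (hy : B.valuation (y - algebraMap K L g - algebraMap F L c) < 1) :
      HasPlaceType F B y (.ramified m) := by
    have hBF := (himm.isRationalPlace hB hA).algebraMap_mem
    refine ((hg.map_of_isImmediate hB himm).congr ?_).hasPlaceType_ramified hBF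
    rw [← sub_add_cancel (y - _) (algebraMap F L c)]
    exact B.add_mem _ _ ((B.valuation_le_one_iff _).1 hy.le) (hBF c)
  exact ⟨B₁, B₂, hsplit, hasPlaceType B₁ c hsplit.comap_left hsplit.isImmediate_left hy₁,
    hasPlaceType B₂ (c + 1) hsplit.comap_right hsplit.isImmediate_right hy₂⟩

end PoleInEquation

end PlaceTypes

section RegularEquation

variable {F K L : Type*} [Field F] [Field K] [Field L] [Algebra F K] [Algebra F L] [Algebra K L]
  [IsScalarTower F K L] {A : ValuationSubring K} {B : ValuationSubring L} {m : ℕ} {ω : F}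

section Identities

variable {w x y : K}

theorem one_div_add_one_div_of_sq_add_self_add_one (h2 : (2 : K) = 0) (hw : w ^ 2 + w + 1 = 0)
    (hx : x ≠ 0) (hx1 : x + 1 ≠ 0) (hy : y ^ 2 + y = x + 1 + 1 / x) :
    1 / (y + w) + 1 / (y + w + 1) = (1 / (x + 1)) ^ 2 + 1 / (x + 1) := by
  have hprod : (y + w) * (y + w + 1) * x = (x + 1) ^ 2 := by
    field_simp at hy
    grind
  have hyw : y + w ≠ 0 := by
    intro h0
    rw [h0, zero_mul, zero_mul] at hprod
    exact pow_ne_zero 2 hx1 hprod.symm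
  have hyw1 : y + w + 1 ≠ 0 := by
    intro h0
    rw [h0, mul_zero, zero_mul] at hprod
    exact pow_ne_zero 2 hx1 hprod.symm
  field_simp
  grind

theorem add_one_add_one_div_eq (h2 : (2 : K) = 0) (hw : w ^ 2 + w + 1 = 0) (hx : x ≠ 0) :
    x + 1 + 1 / x = (x + w) * (x + w + 1) / x := by
  field_simp
  grind

theorem one_div_add_one_div_of_sq_add_self (h2 : (2 : K) = 0) (hw : w ^ 2 + w + 1 = 0)
    (hx : x ≠ 0) (hxw : x + w ≠ 0) (hxw1 : x + w + 1 ≠ 0) (hy : y ^ 2 + y = x + 1 + 1 / x) :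
    1 / y + 1 / (y + 1) = w / (x + w) + w ^ 2 / (x + w + 1) := by
  rw [add_one_add_one_div_eq h2 hw hx] at hy
  have hprod : y * (y + 1) ≠ 0 := by
    rw [mul_add_one, ← sq, hy]
    exact div_ne_zero (mul_ne_zero hxw hxw1) hx
  have hy0 := left_ne_zero_of_mul hprod
  have hy1 := right_ne_zero_of_mul hprod
  field_simp at hy ⊢
  grind

end Identities

theorem valuation_lt_one_of_one_div_notMem {z : K} (hz : 1 / z ∉ A) :
    z ≠ 0 ∧ A.valuation z < 1 := by
  refine ⟨?_, ?_⟩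
  · rintro rfl
    exact hz (by rw [div_zero]; exact A.zero_mem)
  · simpa using valuation_inv_lt_one_iff.2 (Or.inr hz)

theorem sq_add_self_add_one_eq_zero_of_valuation_lt_one {y : K}
    (hA : ∀ c : F, algebraMap F K c ∈ A) (hy : A.valuation (y ^ 2 + y + 1) < 1)
    (hyω : A.valuation (y - algebraMap F K ω) < 1) : ω ^ 2 + ω + 1 = 0 := by
  by_contra hω
  refine (valuation_algebraMap_eq_one hA hω).not_lt ?_
  have hyA : y ∈ A := by
    rw [← sub_add_cancel y (algebraMap F K ω)]
    exact A.add_mem _ _ ((A.valuation_le_one_iff _).1 hyω.le) (hA ω)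
  have hfactor : A.valuation ((y - algebraMap F K ω) * (y + algebraMap F K ω + 1)) < 1 := by
    rw [map_mul]
    exact mul_lt_one_of_lt_of_le hyω <|
      (A.valuation_le_one_iff _).2 (A.add_mem _ _ (A.add_mem _ _ hyA (hA ω)) A.one_mem)
  convert Valuation.map_sub_lt _ hy hfactor using 2
  simp only [map_add, map_pow, map_one]
  ring

theorem HasPlaceType.valuation_lt_one_of_one {x : K} (h2 : (2 : K) = 0)
    (hA : ∀ c : F, algebraMap F K c ∈ A) (hx : HasPlaceType F A x (.one m)) :
    x ≠ 0 ∧ x + 1 ≠ 0 ∧ A.valuation (x + 1 + 1 / x + 1) < 1 := by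
  obtain ⟨hx1_ne, hx1⟩ := valuation_lt_one_of_one_div_notMem (PoleChain.notMem hA hx)
  have hxv : A.valuation x = 1 := by
    have hx11 : x + 1 + 1 = x := by linear_combination h2
    simpa only [hx11] using valuation_add_one_eq_one hx1
  have hx0 := ne_zero_of_valuation_eq_one hxv
  refine ⟨hx0, hx1_ne, ?_⟩
  have hf : x + 1 + 1 / x + 1 = (x + 1) ^ 2 / x := by
    field_simp
    ring
  rw [hf, map_div₀, hxv, div_one, map_pow]
  exact pow_lt_one₀ zero_le hx1 two_ne_zero

theorem valuation_of_cubeRoot {x : K} (hA : ∀ c : F, algebraMap F K c ∈ A)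
    (hω : ω ^ 2 + ω + 1 = 0)
    (hx : PoleChain F A m (algebraMap F K ω / (x + algebraMap F K ω))) :
    A.valuation x = 1 ∧ x + algebraMap F K ω ≠ 0 ∧ A.valuation (x + algebraMap F K ω) < 1 := by
  have hωv := valuation_algebraMap_eq_one hA (ne_zero_of_sq_add_self_add_one hω)
  have hpole := hx.notMem hA
  rw [← one_div_div] at hpole
  obtain ⟨hdiv, hlt⟩ := valuation_lt_one_of_one_div_notMem hpole
  rw [map_div₀, hωv, div_one] at hlt
  refine ⟨?_, fun h0 => hdiv (by rw [h0, zero_div]), hlt⟩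
  rw [← hωv, ← add_sub_cancel_right x (algebraMap F K ω)]
  exact Valuation.map_sub_eq_of_lt_right _ (hωv ▸ hlt)

theorem hasPlaceType_generic_of_valuation {y : K} (hy : A.valuation (y ^ 2 + y) = 1)
    (hy1 : A.valuation (y ^ 2 + y + 1) = 1) : HasPlaceType F A y .generic := by
  have hyA : y ∈ A := mem_of_sq_add_self_mem ((A.valuation_le_one_iff _).1 hy.le)
  have hle : A.valuation y ≤ 1 := (A.valuation_le_one_iff _).2 hyA
  have hle1 : A.valuation (y + 1) ≤ 1 :=
    (A.valuation_le_one_iff _).2 (A.add_mem _ _ hyA A.one_mem)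
  rw [sq, ← mul_add_one, map_mul] at hy
  exact ⟨le_antisymm hle (hy ▸ mul_le_of_le_one_right' hle1),
    le_antisymm hle1 (hy ▸ mul_le_of_le_one_left' hle), hy1⟩

section Split

variable {x : K} {y : L} (h : IsArtinSchreierGenerator (x + 1 + 1 / x) y)
  (hA : IsRationalPlace F A)

include h hA

theorem hasPlaceType_cubeRoot_of_one (hx : HasPlaceType F A x (.one m))
    (hB : B.comap (algebraMap K L) = A) (himm : IsImmediate K B)
    (hyω : B.valuation (y - algebraMap F L ω) < 1) :
    HasPlaceType F B y (.cubeRoot (m + 1)) := by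
  have h2 := two_eq_zero_of_algebra L h.two_eq_zero
  have hBF := (himm.isRationalPlace hB hA).algebraMap_mem
  obtain ⟨hx0, hx1, hf⟩ := hx.valuation_lt_one_of_one h.two_eq_zero hA.algebraMap_mem
  rw [← valuation_algebraMap_lt_one_iff hB, map_add (algebraMap K L), map_one (algebraMap K L),
    ← h.equation] at hf
  have hω := sq_add_self_add_one_eq_zero_of_valuation_lt_one hBF hf hyω
  have hyω1 : B.valuation (y + algebraMap F L ω + 1) = 1 := by
    convert valuation_add_one_eq_one hyω using 2
    linear_combination algebraMap F L ω * h2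
  have hinv := one_div_add_one_div_of_sq_add_self_add_one (x := algebraMap K L x) h2
    (algebraMap_sq_add_self_add_one L hω) ((map_ne_zero _).2 hx0)
    (by rwa [← map_one (algebraMap K L), ← map_add, map_ne_zero])
    (by simpa using h.equation)
  refine ⟨ω, hω, .step hω (PoleChain.map_of_isImmediate hx hB himm) ?_⟩
  convert B.mul_mem _ _ (hBF ω) (one_div_mem_of_valuation_eq_one hyω1) using 1
  simp only [map_div₀, map_add, map_one]
  rw [← hinv]
  linear_combination -(algebraMap F L ω / (y + algebraMap F L ω + 1)) * h2

theorem splitsWithTypes_of_one [IsAlgClosed F] {t : K} (ht : IsUniformizer A t)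
    (hx : HasPlaceType F A x (.one m)) :
    SplitsWithTypes F A y (.cubeRoot (m + 1)) (.cubeRoot (m + 1)) := by
  obtain ⟨-, -, hf⟩ := hx.valuation_lt_one_of_one h.two_eq_zero hA.algebraMap_mem
  have hfA : x + 1 + 1 / x ∈ A := by
    rw [← add_sub_cancel_right (x + 1 + 1 / x) 1]
    exact A.sub_mem ((A.valuation_le_one_iff _).1 hf.le) A.one_mem
  obtain ⟨c, B₁, B₂, hsplit, hy₁, hy₂⟩ := h.exists_splitsInto_of_mem ht hA hfA
  exact ⟨B₁, B₂, hsplit,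
    hasPlaceType_cubeRoot_of_one h hA hx hsplit.comap_left hsplit.isImmediate_left hy₁,
    hasPlaceType_cubeRoot_of_one h hA hx hsplit.comap_right hsplit.isImmediate_right hy₂⟩

omit [Algebra F L] [IsScalarTower F K L] in
theorem one_div_add_one_div_sub_mem (hω : ω ^ 2 + ω + 1 = 0)
    (hx : PoleChain F A m (algebraMap F K ω / (x + algebraMap F K ω)))
    (hB : B.comap (algebraMap K L) = A) :
    1 / y + 1 / (y + 1) - algebraMap K L (algebraMap F K ω / (x + algebraMap F K ω)) ∈ B := by
  obtain ⟨hxv, hxω0, hxω⟩ := valuation_of_cubeRoot hA.algebraMap_mem hω hx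
  have hxω1 := valuation_add_one_eq_one hxω
  have hinv := one_div_add_one_div_of_sq_add_self (x := algebraMap K L x)
    (w := algebraMap K L (algebraMap F K ω)) (two_eq_zero_of_algebra L h.two_eq_zero)
    (algebraMap_sq_add_self_add_one L (algebraMap_sq_add_self_add_one K hω))
    ((map_ne_zero _).2 (ne_zero_of_valuation_eq_one hxv)) (by rwa [← map_add, map_ne_zero])
    (by rw [← map_one (algebraMap K L), ← map_add, ← map_add, map_ne_zero]
        exact ne_zero_of_valuation_eq_one hxω1)
    (by simpa using h.equation)
  have hmem : algebraMap F K ω ^ 2 / (x + algebraMap F K ω + 1) ∈ A := by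
    rw [← mul_one_div]
    exact A.mul_mem _ _ (pow_mem (hA.algebraMap_mem ω) 2) (one_div_mem_of_valuation_eq_one hxω1)
  convert (algebraMap_mem_iff hB _).2 hmem using 1
  simp only [map_div₀, map_add, map_pow, map_one]
  rw [hinv, add_sub_cancel_left]

theorem splitsWithTypes_of_cubeRoot {t : K} (ht : IsUniformizer A t)
    (hx : HasPlaceType F A x (.cubeRoot m)) : SplitsWithTypes F A y (.ramified m) (.one m) := by
  obtain ⟨ω, hω, hx⟩ := hx
  obtain ⟨hxv, -, hxω⟩ := valuation_of_cubeRoot hA.algebraMap_mem hω hx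
  have hf : A.valuation (x + 1 + 1 / x) < 1 := by
    rwa [add_one_add_one_div_eq h.two_eq_zero (algebraMap_sq_add_self_add_one K hω)
      (ne_zero_of_valuation_eq_one hxv), map_div₀, hxv, div_one, map_mul,
      valuation_add_one_eq_one hxω, mul_one]
  obtain ⟨B₁, B₂, hsplit, hy₁, hy₂⟩ := h.exists_splitsInto ht hf
  refine ⟨B₁, B₂, hsplit,
    (hx.map_of_isImmediate hsplit.comap_left hsplit.isImmediate_left).congr ?_,
    (hx.map_of_isImmediate hsplit.comap_right hsplit.isImmediate_right).congr ?_⟩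
  · have hy₁' : y + 1 - 1 / (y + 1) ∈ B₁ :=
      B₁.sub_mem (B₁.add_mem _ _ ((B₁.valuation_le_one_iff _).1 hy₁.le) B₁.one_mem)
        (one_div_mem_of_valuation_eq_one (valuation_add_one_eq_one hy₁))
    convert B₁.add_mem _ _ (one_div_add_one_div_sub_mem h hA hω hx hsplit.comap_left) hy₁' using 1
    ring
  · have hyv : B₂.valuation y = 1 := by
      convert valuation_add_one_eq_one hy₂ using 2
      linear_combination -two_eq_zero_of_algebra L h.two_eq_zero
    rw [← add_sub_cancel_left (1 / y) (1 / (y + 1)), sub_right_comm]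
    exact B₂.sub_mem (one_div_add_one_div_sub_mem h hA hω hx hsplit.comap_right)
      (one_div_mem_of_valuation_eq_one hyv)

theorem splitsWithTypes_of_generic [IsAlgClosed F] {t : K} (ht : IsUniformizer A t)
    (hx : HasPlaceType F A x .generic) : SplitsWithTypes F A y .generic .generic := by
  obtain ⟨hx0, hx1, hx2⟩ := hx
  have hx_ne := ne_zero_of_valuation_eq_one hx0
  have hf : A.valuation (x + 1 + 1 / x) = 1 := by
    rw [show x + 1 + 1 / x = (x ^ 2 + x + 1) / x by field_simp, map_div₀, hx0, hx2, div_one]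
  have hf1 : A.valuation (x + 1 + 1 / x + 1) = 1 := by
    rw [show x + 1 + 1 / x + 1 = (x + 1) ^ 2 / x by field_simp; ring, map_div₀, map_pow, hx0, hx1,
      div_one, one_pow]
  have hgeneric {B : ValuationSubring L} (hB : B.comap (algebraMap K L) = A) :
      HasPlaceType F B y .generic := by
    rw [← map_one A.valuation, ← valuation_algebraMap_eq_iff hB, map_one (algebraMap K L),
      map_one B.valuation] at hf hf1
    rw [← h.equation] at hf
    rw [map_add (algebraMap K L), map_one (algebraMap K L), ← h.equation] at hf1
    exact hasPlaceType_generic_of_valuation hf hf1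
  obtain ⟨_, B₁, B₂, hsplit, -, -⟩ :=
    h.exists_splitsInto_of_mem ht hA ((A.valuation_le_one_iff _).1 hf.le)
  exact ⟨B₁, B₂, hsplit, hgeneric hsplit.comap_left, hgeneric hsplit.comap_right⟩

end Split

end RegularEquation

section Points

namespace CurvePoint

variable {k K L : Type*} [Field k] [Field K] [Field L] [Algebra k K] [Algebra k L] [Algebra K L]
  {P : CurvePoint k K} {Q : CurvePoint k L}

@[ext]
theorem ext {P' : CurvePoint k K} (h : P.localRing = P'.localRing) : P = P' := by
  cases P
  cases P'
  congr

/-- The point whose local ring is a given valuation ring with a uniformizer. -/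
def ofIsUniformizer {A : ValuationSubring K} (hA : ∀ c : k, algebraMap k K c ∈ A) {t : K}
    (ht : IsUniformizer A t) : CurvePoint k K :=
  ⟨A, hA, ht.isDiscreteValuationRing⟩

theorem exists_isUniformizer (P : CurvePoint k K) : ∃ t, IsUniformizer P.localRing t :=
  have := P.isDVR
  _root_.exists_isUniformizer P.localRing

theorem map_maximalIdeal_eq_pow_iff (h : Q.LiesOver P) {t : K} {s : L}
    (ht : IsUniformizer P.localRing t) (hs : IsUniformizer Q.localRing s) (n : ℕ) :
    (IsLocalRing.maximalIdeal P.localRing).map (localHom h) =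
        IsLocalRing.maximalIdeal Q.localRing ^ n ↔
      Q.localRing.valuation (algebraMap K L t) = Q.localRing.valuation s ^ n := by
  rw [ht.maximalIdeal_eq, hs.maximalIdeal_eq, Ideal.map_span, Set.image_singleton,
    Ideal.span_singleton_pow, Ideal.span_singleton_eq_span_singleton, ← map_pow,
    eq_comm (a := Q.localRing.valuation _), Q.localRing.valuation_eq_iff]
  refine exists_congr fun u => ?_
  rw [Subtype.ext_iff, mul_comm]
  rfl

theorem isTotallyRamified_of_ramifiesInto {B : ValuationSubring L}
    (h : RamifiesInto P.localRing B) (hB : ∀ c : k, algebraMap k L c ∈ B)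
    (hdeg : Module.finrank K L = 2) : P.IsTotallyRamified L := by
  obtain ⟨t, s, ht, hs, hts⟩ := h.exists_isUniformizer
  have hQP : (ofIsUniformizer hB hs).LiesOver P := h.comap_eq
  exact ⟨_, hQP, (map_maximalIdeal_eq_pow_iff hQP ht hs _).2 (hdeg ▸ hts)⟩

theorem not_isTotallyRamified_of_isImmediate
    (h : ∀ B : ValuationSubring L, B.comap (algebraMap K L) = P.localRing → IsImmediate K B)
    (hdeg : Module.finrank K L ≠ 1) : ¬ P.IsTotallyRamified L := by
  rintro ⟨Q, hQP, hQ⟩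
  obtain ⟨t, ht⟩ := P.exists_isUniformizer
  have hs := (h Q.localRing hQP).isUniformizer_algebraMap hQP ht
  rw [map_maximalIdeal_eq_pow_iff hQP ht hs] at hQ
  refine hdeg (pow_right_injective₀ hs.valuation_pos hs.valuation_lt_one.ne ?_)
  simpa using hQ.symm

theorem not_isTotallyRamified_of_splitsInto {B₁ B₂ : ValuationSubring L}
    (h : SplitsInto P.localRing B₁ B₂) (hdeg : Module.finrank K L ≠ 1) :
    ¬ P.IsTotallyRamified L :=
  not_isTotallyRamified_of_isImmediate (fun B hB => (h.eq_or_eq B hB).elim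
    (fun hB₁ => hB₁ ▸ h.isImmediate_left) (fun hB₂ => hB₂ ▸ h.isImmediate_right)) hdeg

end CurvePoint

end Points

section RationalFunctionField

open Polynomial IntermediateField

variable {F K : Type*} [Field F] [Field K] [Algebra F K] {A A' : ValuationSubring K} {t z : K}
  {p q : F[X]}

theorem exists_aeval_eq_pow_mul (t : K) (hp : p ≠ 0) :
    ∃ (n : ℕ) (q : F[X]), q.coeff 0 ≠ 0 ∧ aeval t p = t ^ n * aeval t q := by
  obtain ⟨q, hpq, hq⟩ := exists_eq_pow_rootMultiplicity_mul_and_not_dvd p hp 0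
  rw [map_zero, sub_zero] at hpq hq
  refine ⟨rootMultiplicity 0 p, q, fun h => hq (X_dvd_iff.2 h), ?_⟩
  simpa only [map_mul, map_pow, aeval_X] using congrArg (aeval t) hpq

theorem exists_eq_zpow_mul_aeval_div_aeval (htop : F⟮t⟯ = ⊤) (ht0 : t ≠ 0) (hz : z ≠ 0) :
    ∃ (n : ℤ) (p q : F[X]), p.coeff 0 ≠ 0 ∧ q.coeff 0 ≠ 0 ∧
      z = t ^ n * (aeval t p / aeval t q) := by
  obtain ⟨p, q, rfl⟩ := mem_adjoin_simple_iff F z |>.1 (htop ▸ mem_top)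
  obtain ⟨hp0, hq0⟩ := div_ne_zero_iff.1 hz
  obtain ⟨n, p', hp', hp⟩ := exists_aeval_eq_pow_mul t (p := p) (by rintro rfl; simp at hp0)
  obtain ⟨m, q', hq', hq⟩ := exists_aeval_eq_pow_mul t (p := q) (by rintro rfl; simp at hq0)
  refine ⟨n - m, p', q', hp', hq', ?_⟩
  rw [hp, hq, zpow_sub₀ ht0, zpow_natCast, zpow_natCast, mul_div_mul_comm]

section Zero

variable (hA : ∀ c : F, algebraMap F K c ∈ A) (ht : A.valuation t < 1)

include hA ht

theorem valuation_aeval_sub_coeff_zero_lt_one (p : F[X]) :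
    A.valuation (aeval t p - algebraMap F K (p.coeff 0)) < 1 := by
  have htA : t ∈ A := (A.valuation_le_one_iff t).1 ht.le
  have hmem : aeval t p.divX ∈ A := by
    rw [aeval_eq_sum_range]
    refine sum_mem fun i _ => ?_
    rw [Algebra.smul_def]
    exact A.mul_mem _ _ (hA _) (pow_mem htA i)
  have hdivX : aeval t p - algebraMap F K (p.coeff 0) = t * aeval t p.divX := by
    rw [sub_eq_iff_eq_add]
    simpa only [map_add, map_mul, aeval_X, aeval_C] using congrArg (aeval t) p.X_mul_divX_add.symm
  rw [hdivX, map_mul]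
  exact mul_lt_one_of_lt_of_le ht ((A.valuation_le_one_iff _).2 hmem)

theorem valuation_aeval_eq_one (hp : p.coeff 0 ≠ 0) : A.valuation (aeval t p) = 1 := by
  have hc := valuation_algebraMap_eq_one hA hp
  rw [← hc, ← sub_add_cancel (aeval t p) (algebraMap F K (p.coeff 0))]
  exact Valuation.map_add_eq_of_lt_right _
    (hc ▸ valuation_aeval_sub_coeff_zero_lt_one hA ht p)

theorem valuation_zpow_mul_aeval_div_aeval (n : ℤ) (hp : p.coeff 0 ≠ 0) (hq : q.coeff 0 ≠ 0) :
    A.valuation (t ^ n * (aeval t p / aeval t q)) = A.valuation t ^ n := by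
  rw [map_mul, map_div₀, valuation_aeval_eq_one hA ht hp, valuation_aeval_eq_one hA ht hq,
    div_one, mul_one, map_zpow₀]

theorem valuation_aeval_div_aeval_sub_lt_one (p : F[X]) (hq : q.coeff 0 ≠ 0) :
    A.valuation (aeval t p / aeval t q - algebraMap F K (p.coeff 0 / q.coeff 0)) < 1 := by
  have hqv := valuation_aeval_eq_one hA ht hq
  have hcoeff : (p - C (p.coeff 0 / q.coeff 0) * q).coeff 0 = 0 := by
    rw [coeff_sub, coeff_C_mul, div_mul_cancel₀ _ hq, sub_self]
  have hlt := valuation_aeval_sub_coeff_zero_lt_one hA ht (p - C (p.coeff 0 / q.coeff 0) * q)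
  rw [hcoeff, map_zero, sub_zero, map_sub, map_mul, aeval_C] at hlt
  rwa [div_sub' (ne_zero_of_valuation_eq_one hqv), map_div₀, hqv, div_one, mul_comm]

theorem isUniformizer_of_adjoin_eq_top (htop : F⟮t⟯ = ⊤) (ht0 : t ≠ 0) : IsUniformizer A t where
  ne_zero := ht0
  valuation_lt_one := ht
  exists_zpow z hz := by
    obtain ⟨n, p, q, hp, hq, rfl⟩ := exists_eq_zpow_mul_aeval_div_aeval htop ht0 hz
    exact ⟨n, valuation_zpow_mul_aeval_div_aeval hA ht n hp hq⟩

theorem isRationalPlace_of_adjoin_eq_top (htop : F⟮t⟯ = ⊤) (ht0 : t ≠ 0) :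
    IsRationalPlace F A where
  algebraMap_mem := hA
  exists_residue z hz := by
    rcases ((A.valuation_le_one_iff z).2 hz).lt_or_eq with hlt | heq
    · exact ⟨0, by rwa [map_zero, sub_zero]⟩
    obtain ⟨n, p, q, hp, hq, rfl⟩ :=
      exists_eq_zpow_mul_aeval_div_aeval htop ht0 (ne_zero_of_valuation_eq_one heq)
    rw [valuation_zpow_mul_aeval_div_aeval hA ht n hp hq,
      zpow_eq_one_iff_right₀ zero_le ht.ne] at heq
    rw [heq, zpow_zero, one_mul]
    exact ⟨_, valuation_aeval_div_aeval_sub_lt_one hA ht p hq⟩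

theorem eq_of_adjoin_eq_top (htop : F⟮t⟯ = ⊤) (ht0 : t ≠ 0)
    (hA' : ∀ c : F, algebraMap F K c ∈ A') (ht' : A'.valuation t < 1) : A = A' := by
  ext z
  rcases eq_or_ne z 0 with rfl | hz0
  · exact iff_of_true A.zero_mem A'.zero_mem
  obtain ⟨n, p, q, hp, hq, rfl⟩ := exists_eq_zpow_mul_aeval_div_aeval htop ht0 hz0
  rw [← A.valuation_le_one_iff, ← A'.valuation_le_one_iff,
    valuation_zpow_mul_aeval_div_aeval hA ht n hp hq,
    valuation_zpow_mul_aeval_div_aeval hA' ht' n hp hq,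
    zpow_le_one_iff_right_of_lt_one₀ (A.valuation.pos_iff.2 ht0) ht,
    zpow_le_one_iff_right_of_lt_one₀ (A'.valuation.pos_iff.2 ht0) ht']

end Zero

theorem not_isUnit_of_transcendental (ht : Transcendental F t) :
    ¬ IsUnit (⟨t, Algebra.self_mem_adjoin_singleton F t⟩ : Algebra.adjoin F {t}) := by
  rw [isUnit_iff_exists_inv]
  rintro ⟨⟨s, hs⟩, hst⟩
  rw [Algebra.adjoin_singleton_eq_range_aeval] at hs
  obtain ⟨p, rfl⟩ := hs
  have haeval : aeval t (X * p - 1) = 0 := by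
    rw [map_sub, map_mul, aeval_X, map_one, sub_eq_zero]
    exact congrArg Subtype.val hst
  simpa using congrArg (coeff · 0) (transcendental_iff.1 ht _ haeval)

theorem exists_valuation_lt_one_of_transcendental (ht : Transcendental F t) :
    ∃ A : ValuationSubring K, (∀ c : F, algebraMap F K c ∈ A) ∧ A.valuation t < 1 := by
  have htm : t ∈ Algebra.adjoin F {t} := Algebra.self_mem_adjoin_singleton F t
  obtain ⟨A, hle, hnonunits⟩ := Ideal.image_subset_nonunits_valuationSubring
    (A := (Algebra.adjoin F {t}).toSubring) (Ideal.span {⟨t, htm⟩}) <| by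
      rw [Ne, Ideal.span_singleton_eq_top]
      exact not_isUnit_of_transcendental ht
  refine ⟨A, fun c => hle ((Algebra.adjoin F {t}).algebraMap_mem c), ?_⟩
  rw [← ValuationSubring.mem_nonunits_iff]
  exact hnonunits ⟨⟨t, htm⟩, Ideal.subset_span rfl, rfl⟩

theorem valuation_aeval_eq_one_of_forall [IsAlgClosed F] (hA : ∀ c : F, algebraMap F K c ∈ A)
    (ht : ∀ a : F, A.valuation (t - algebraMap F K a) = 1) (hp : p ≠ 0) :
    A.valuation (aeval t p) = 1 := by
  rw [(IsAlgClosed.splits p).eq_prod_roots, map_mul, map_mul, aeval_C,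
    valuation_algebraMap_eq_one hA (leadingCoeff_ne_zero.2 hp), one_mul, map_multiset_prod,
    map_multiset_prod, Multiset.map_map, Multiset.map_map]
  refine Multiset.prod_eq_one fun v hv => ?_
  obtain ⟨a, -, rfl⟩ := Multiset.mem_map.1 hv
  simpa using ht a

theorem exists_valuation_sub_lt_one_of_ne_top [IsAlgClosed F] (htop : F⟮t⟯ = ⊤)
    (hA : ∀ c : F, algebraMap F K c ∈ A) (hA_top : A ≠ ⊤) (ht : t ∈ A) :
    ∃ a : F, A.valuation (t - algebraMap F K a) < 1 := by
  by_contra! hge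
  have hunit (a : F) : A.valuation (t - algebraMap F K a) = 1 :=
    le_antisymm ((A.valuation_le_one_iff _).2 (A.sub_mem ht (hA a))) (hge a)
  refine hA_top (eq_top_iff.2 fun z _ => ?_)
  rcases eq_or_ne z 0 with rfl | hz0
  · exact A.zero_mem
  obtain ⟨p, q, rfl⟩ := mem_adjoin_simple_iff F z |>.1 (htop ▸ mem_top)
  obtain ⟨hp0, hq0⟩ := div_ne_zero_iff.1 hz0
  rw [← A.valuation_le_one_iff, map_div₀,
    valuation_aeval_eq_one_of_forall hA hunit (p := p) (by rintro rfl; simp at hp0),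
    valuation_aeval_eq_one_of_forall hA hunit (p := q) (by rintro rfl; simp at hq0), div_one]

end RationalFunctionField

section ProjectiveLine

open IntermediateField OnePoint

variable {F K : Type*} [Field F] [Field K] [Algebra F K] {A : ValuationSubring K} {x : K} {a : F}

/-- The standard local parameter at a point of the projective line over `F` with affine
coordinate `x`. -/
def localParameter {F K : Type*} [Field F] [Field K] [Algebra F K] (x : K) : OnePoint F → K
  | ∞ => x⁻¹
  | OnePoint.some a => x - algebraMap F K a

theorem localParameter_coe (x : K) (a : F) :
    localParameter x (a : OnePoint F) = x - algebraMap F K a :=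
  rfl

theorem adjoin_localParameter (x : K) (p : OnePoint F) :
    F⟮(localParameter x p : K)⟯ = F⟮x⟯ := by
  have hmem (y : K) : y ∈ F⟮y⟯ := mem_adjoin_simple_self F y
  cases p with
  | infty =>
    refine le_antisymm (adjoin_simple_le_iff.2 (inv_mem (hmem x))) (adjoin_simple_le_iff.2 ?_)
    change x ∈ F⟮x⁻¹⟯
    simpa only [inv_inv] using inv_mem (hmem x⁻¹)
  | coe a =>
    refine le_antisymm (adjoin_simple_le_iff.2 (sub_mem (hmem x) (F⟮x⟯.algebraMap_mem a)))
      (adjoin_simple_le_iff.2 ?_)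
    rw [localParameter_coe]
    simpa only [sub_add_cancel] using add_mem (hmem (x - algebraMap F K a))
      (IntermediateField.algebraMap_mem _ a)

theorem transcendental_localParameter (hx : Transcendental F x) (p : OnePoint F) :
    Transcendental F (localParameter x p) := by
  cases p with
  | infty => exact fun h => hx (inv_inv x ▸ h.inv)
  | coe a => exact fun h => hx (sub_add_cancel x _ ▸ h.add (isAlgebraic_algebraMap a))

theorem localParameter_ne_zero (hx : Transcendental F x) (p : OnePoint F) :
    localParameter x p ≠ 0 :=
  fun h => transcendental_localParameter hx p (h ▸ isAlgebraic_zero)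

theorem exists_isUniformizer_localParameter (htop : F⟮x⟯ = ⊤) (hx : Transcendental F x)
    (p : OnePoint F) :
    ∃ A : ValuationSubring K, IsRationalPlace F A ∧ IsUniformizer A (localParameter x p) := by
  have hp0 := localParameter_ne_zero hx p
  obtain ⟨A, hA, hpA⟩ :=
    exists_valuation_lt_one_of_transcendental (transcendental_localParameter hx p)
  rw [← adjoin_localParameter x p] at htop
  exact ⟨A, isRationalPlace_of_adjoin_eq_top hA hpA htop hp0,
    isUniformizer_of_adjoin_eq_top hA hpA htop hp0⟩

theorem exists_valuation_localParameter_lt_one [IsAlgClosed F] (htop : F⟮x⟯ = ⊤)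
    (hA : ∀ c : F, algebraMap F K c ∈ A) (hA_top : A ≠ ⊤) :
    ∃ p : OnePoint F, A.valuation (localParameter x p) < 1 := by
  by_cases hx : x ∈ A
  · obtain ⟨a, ha⟩ := exists_valuation_sub_lt_one_of_ne_top htop hA hA_top hx
    exact ⟨a, ha⟩
  · exact ⟨∞, valuation_inv_lt_one_iff.2 (Or.inr hx)⟩

theorem eq_of_valuation_localParameter_lt_one (hA : ∀ c : F, algebraMap F K c ∈ A)
    (hx : x ≠ 0) {p q : OnePoint F} (hp : A.valuation (localParameter x p) < 1)
    (hq : A.valuation (localParameter x q) < 1) : p = q := by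
  have hinf {b : F} (h : A.valuation x⁻¹ < 1) : ¬ A.valuation (x - algebraMap F K b) < 1 := by
    intro hb
    refine (valuation_inv_lt_one_iff.1 h).resolve_left hx ?_
    rw [← sub_add_cancel x (algebraMap F K b)]
    exact A.add_mem _ _ ((A.valuation_le_one_iff _).1 hb.le) (hA b)
  cases p with
  | infty =>
    cases q with
    | infty => rfl
    | coe b => exact (hinf hp hq).elim
  | coe a =>
    cases q with
    | infty => exact (hinf hq hp).elim
    | coe b =>
      congr 1
      by_contra hab
      refine (Valuation.map_sub_lt _ hq hp).ne ?_
      rw [localParameter_coe, localParameter_coe, sub_sub_sub_cancel_left, ← map_sub]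
      exact valuation_algebraMap_eq_one hA (sub_ne_zero.2 hab)

theorem hasPlaceType_infty (hA : ∀ c : F, algebraMap F K c ∈ A)
    (hu : IsUniformizer A (localParameter x (∞ : OnePoint F))) :
    HasPlaceType F A x (.ramified 0) :=
  (PoleChain.simple hu).hasPlaceType_ramified hA

theorem hasPlaceType_zero (hu : IsUniformizer A (localParameter x ((0 : F) : OnePoint F))) :
    HasPlaceType F A x (.ramified 0) := by
  rw [localParameter_coe, map_zero, sub_zero] at hu
  refine (PoleChain.simple (F := F) (y := 1 / x) (by simpa using hu)).congr ?_
  rw [add_sub_cancel_right]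
  exact A.add_mem _ _ hu.mem A.one_mem

theorem hasPlaceType_one (h2 : (2 : K) = 0)
    (hu : IsUniformizer A (localParameter x ((1 : F) : OnePoint F))) :
    HasPlaceType F A x (.one 0) := by
  refine .simple ?_
  rw [one_div, inv_inv]
  convert hu using 1
  rw [localParameter_coe, map_one]
  linear_combination h2

theorem hasPlaceType_cubeRoot (h2 : (2 : K) = 0) (hA : ∀ c : F, algebraMap F K c ∈ A)
    (ha : a ^ 2 + a + 1 = 0) (hu : IsUniformizer A (localParameter x (a : OnePoint F))) :
    HasPlaceType F A x (.cubeRoot 0) := by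
  refine ⟨a, ha, .simple (hu.congr ?_)⟩
  rw [inv_div, map_div₀, valuation_algebraMap_eq_one hA (ne_zero_of_sq_add_self_add_one ha),
    div_one, localParameter_coe]
  congr 1
  linear_combination algebraMap F K a * h2

theorem valuation_eq_one_of_sub_algebraMap {z : K} (hA : ∀ c : F, algebraMap F K c ∈ A)
    (ha : a ≠ 0) (hz : A.valuation (z - algebraMap F K a) < 1) : A.valuation z = 1 := by
  have hav := valuation_algebraMap_eq_one hA ha
  rw [← hav, ← sub_add_cancel z (algebraMap F K a)]
  exact Valuation.map_add_eq_of_lt_right _ (hav ▸ hz)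

theorem hasPlaceType_generic (hA : ∀ c : F, algebraMap F K c ∈ A) (ha0 : a ≠ 0) (ha1 : a + 1 ≠ 0)
    (ha : a ^ 2 + a + 1 ≠ 0) (hx : A.valuation (localParameter x (a : OnePoint F)) < 1) :
    HasPlaceType F A x .generic := by
  have hx1 : A.valuation (x + 1) = 1 := valuation_eq_one_of_sub_algebraMap hA ha1 (by
    rwa [map_add (algebraMap F K), map_one (algebraMap F K), add_sub_add_right_eq_sub])
  refine ⟨valuation_eq_one_of_sub_algebraMap hA ha0 hx, hx1, ?_⟩
  by_contra hne
  have hxA : x ∈ A := by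
    rw [← sub_add_cancel x (algebraMap F K a)]
    exact A.add_mem _ _ ((A.valuation_le_one_iff _).1 hx.le) (hA a)
  exact ha (sq_add_self_add_one_eq_zero_of_valuation_lt_one hA
    (lt_of_le_of_ne ((A.valuation_le_one_iff _).2
      (A.add_mem _ _ (A.add_mem _ _ (pow_mem hxA 2) hxA) A.one_mem)) hne) hx)

end ProjectiveLine

section ArtinSchreierCriterion

open Polynomial IntermediateField

variable {K L : Type*} [Field K] [Field L] [Algebra K L] {f : K} {y : L}
  {A : ValuationSubring K}

theorem exists_repr_of_adjoin_eq_top (hy : y ^ 2 + y = algebraMap K L f) (htop : K⟮y⟯ = ⊤)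
    (z : L) : ∃ a b : K, z = algebraMap K L a + algebraMap K L b * y := by
  have hmonic := IsArtinSchreierGenerator.monic_polynomial f
  have hroot : aeval y (X ^ 2 + X - C f) = 0 := by simp [hy]
  have hint : IsIntegral K y := ⟨_, hmonic, hroot⟩
  have hz : z ∈ Algebra.adjoin K {y} := by
    rw [← adjoin_simple_toSubalgebra_of_isAlgebraic hint.isAlgebraic, htop]
    exact mem_top
  rw [Algebra.adjoin_singleton_eq_range_aeval] at hz
  obtain ⟨p, rfl⟩ := (AlgHom.mem_range _).1 hz
  have hdeg : (p %ₘ (X ^ 2 + X - C f)).degree ≤ 1 := by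
    refine Order.le_of_lt_succ ((degree_modByMonic_lt p hmonic).trans_eq ?_)
    have hdeg : (X ^ 2 + X - C f : K[X]).degree = 2 := by compute_degree!
    exact hdeg
  rw [← aeval_modByMonic_eq_self_of_root hroot,
    eq_X_add_C_of_degree_le_one hdeg]
  exact ⟨_, _, by rw [map_add, map_mul, aeval_C, aeval_C, aeval_X, add_comm]⟩

theorem IsUniformizer.sq_add_self_ne (hf : IsUniformizer A f⁻¹) (a : K) : a ^ 2 + a ≠ f := by
  rintro rfl
  have ha : a ∉ A := fun ha =>
    hf.inv_notMem (by rw [inv_inv]; exact A.add_mem _ _ (pow_mem ha 2) ha)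
  obtain ⟨n, hn⟩ := hf.exists_zpow a (by rintro rfl; exact ha A.zero_mem)
  have hval : A.valuation (a ^ 2 + a)⁻¹ ^ (-1 : ℤ) = A.valuation (a ^ 2 + a)⁻¹ ^ (n * 2) := by
    rw [zpow_mul, ← hn, ← map_zpow₀, zpow_neg_one, inv_inv, valuation_sq_add_self ha]
    rfl
  have := zpow_right_injective₀ hf.valuation_pos hf.valuation_lt_one.ne hval
  lia

theorem IsUniformizer.inv_add_one_add_one_div {z : K} (hz : IsUniformizer A z⁻¹) :
    IsUniformizer A (z + 1 + 1 / z)⁻¹ :=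
  hz.inv_congr (add_one_add_one_div_sub_mem (by simpa only [inv_inv] using hz.inv_notMem))

theorem IsUniformizer.isArtinSchreierGenerator (hf : IsUniformizer A f⁻¹) (h2 : (2 : K) = 0)
    (hy : y ^ 2 + y = algebraMap K L f) (htop : K⟮y⟯ = ⊤) : IsArtinSchreierGenerator f y where
  two_eq_zero := h2
  equation := hy
  exists_repr := exists_repr_of_adjoin_eq_top hy htop
  notMem_range := by
    rintro ⟨a, rfl⟩
    refine hf.sq_add_self_ne a ((algebraMap K L).injective ?_)
    rw [map_add, map_pow, hy]

theorem comap_algebraMap_ne_top [Algebra.IsAlgebraic K L] {B : ValuationSubring L} (hB : B ≠ ⊤) :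
    B.comap (algebraMap K L) ≠ ⊤ := by
  contrapose! hB
  refine eq_top_iff.2 fun z _ => ?_
  by_contra hz
  obtain ⟨c, hc, hcz⟩ := exists_valuation_algebraMap_le (K := K) B (z := z⁻¹)
    (inv_ne_zero (by rintro rfl; exact hz B.zero_mem))
  have hc_inv : algebraMap K L c⁻¹ ∈ B := by
    rw [← ValuationSubring.mem_comap, hB]
    exact ValuationSubring.mem_top _
  have hc_lt : B.valuation (algebraMap K L c⁻¹)⁻¹ < 1 := by
    rw [map_inv₀ (algebraMap K L), inv_inv]
    exact hcz.trans_lt (valuation_inv_lt_one_iff.2 (Or.inr hz))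
  rcases valuation_inv_lt_one_iff.1 hc_lt with h | h
  · exact inv_ne_zero hc ((map_eq_zero _).1 h)
  · exact h hc_inv

end ArtinSchreierCriterion

section Tower

open IntermediateField

variable (F : Type*) {Ω : Type*} [Field F] [Field Ω] [Algebra F Ω] (x : ℕ → Ω)

/-- The coordinate `x_i` as a function on the curve `C_i`. -/
def towerCoord (i : ℕ) : towerField F x i :=
  ⟨x i, subset_adjoin F _ ⟨i, le_rfl, rfl⟩⟩

theorem towerField_mono : Monotone (towerField F x) :=
  monotone_nat_of_le_succ (towerField_le_succ F x)

/-- The inclusion of function fields given by the cover `C_n → C_i`. -/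
noncomputable def towerInclusion {i n : ℕ} (h : i ≤ n) : towerField F x i →+* towerField F x n :=
  (inclusion (towerField_mono F x h)).toRingHom

theorem algebraMap_eq_towerInclusion (i : ℕ) :
    algebraMap (towerField F x i) (towerField F x (i + 1)) = towerInclusion F x i.le_succ :=
  rfl

theorem comap_towerInclusion_self {i : ℕ} (A : ValuationSubring (towerField F x i)) :
    A.comap (towerInclusion F x le_rfl) = A :=
  ValuationSubring.ext _ _ fun _ => Iff.rfl

theorem towerInclusion_comp {i j n : ℕ} (hij : i ≤ j) (hjn : j ≤ n) :
    (towerInclusion F x hjn).comp (towerInclusion F x hij) = towerInclusion F x (hij.trans hjn) :=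
  rfl

instance towerAlgebra_isScalarTower (i : ℕ) :
    IsScalarTower F (towerField F x i) (towerField F x (i + 1)) :=
  IsScalarTower.of_algebraMap_eq fun _ => rfl

variable {F x}

theorem eq_top_of_forall_towerInclusion_towerCoord_mem {n : ℕ}
    {E : IntermediateField F (towerField F x n)}
    (hE : ∀ (i : ℕ) (hi : i ≤ n), towerInclusion F x hi (towerCoord F x i) ∈ E) : E = ⊤ := by
  have hle : towerField F x n ≤ lift E := by
    refine adjoin_le_iff.2 ?_
    rintro _ ⟨i, hi, rfl⟩
    exact (mem_lift _).2 (hE i hi)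
  exact eq_top_iff.2 fun z _ => (mem_lift z).1 (hle z.2)

theorem adjoin_towerCoord_zero : F⟮towerCoord F x 0⟯ = ⊤ := by
  refine eq_top_of_forall_towerInclusion_towerCoord_mem fun i hi => ?_
  obtain rfl := Nat.le_zero.1 hi
  exact mem_adjoin_simple_self F _

theorem adjoin_towerCoord_succ (i : ℕ) : (towerField F x i)⟮towerCoord F x (i + 1)⟯ = ⊤ := by
  refine restrictScalars_injective F ?_
  refine eq_top_of_forall_towerInclusion_towerCoord_mem fun j hj => ?_
  rcases Nat.le_succ_iff.1 hj with hji | rfl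
  · rw [← towerInclusion_comp F x hji i.le_succ]
    exact IntermediateField.algebraMap_mem (towerField F x i)⟮towerCoord F x (i + 1)⟯
      (towerInclusion F x hji (towerCoord F x j))
  · exact mem_adjoin_simple_self _ (towerCoord F x (i + 1))

namespace IsTowerSequence

variable (hx : IsTowerSequence F x)

include hx

theorem transcendental_towerCoord_zero : Transcendental F (towerCoord F x 0) :=
  (transcendental_algebraMap_iff (algebraMap (towerField F x 0) Ω).injective).1
    hx.transcendental_zero

theorem towerCoord_equation (i : ℕ) :
    towerCoord F x (i + 1) ^ 2 + towerCoord F x (i + 1) =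
      algebraMap (towerField F x i) (towerField F x (i + 1))
        (towerCoord F x i + 1 + 1 / towerCoord F x i) :=
  Subtype.ext (hx.equation i)

theorem exists_isUniformizer_inv_towerCoord (h2 : (2 : F) = 0) (i : ℕ) :
    ∃ A : ValuationSubring (towerField F x i), IsUniformizer A (towerCoord F x i)⁻¹ := by
  induction i with
  | zero =>
    obtain ⟨A, -, hA⟩ := exists_isUniformizer_localParameter adjoin_towerCoord_zero
      hx.transcendental_towerCoord_zero OnePoint.infty
    exact ⟨A, hA⟩
  | succ i ih =>
    obtain ⟨A, hA⟩ := ih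
    have hf := hA.inv_add_one_add_one_div
    obtain ⟨B, hB⟩ := exists_comap_algebraMap_eq (towerField F x (i + 1)) A
    exact ⟨B, (hf.isArtinSchreierGenerator (two_eq_zero_of_algebra _ h2)
      (hx.towerCoord_equation i) (adjoin_towerCoord_succ i)).isUniformizer_inv hf hB⟩

theorem isArtinSchreierGenerator_towerCoord (h2 : (2 : F) = 0) (i : ℕ) :
    IsArtinSchreierGenerator (towerCoord F x i + 1 + 1 / towerCoord F x i)
      (towerCoord F x (i + 1)) := by
  obtain ⟨A, hA⟩ := hx.exists_isUniformizer_inv_towerCoord h2 i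
  exact hA.inv_add_one_add_one_div.isArtinSchreierGenerator (two_eq_zero_of_algebra _ h2)
    (hx.towerCoord_equation i) (adjoin_towerCoord_succ i)

theorem comap_towerInclusion_ne_top (h2 : (2 : F) = 0) {n : ℕ}
    {B : ValuationSubring (towerField F x n)} (hB : B ≠ ⊤) :
    B.comap (towerInclusion F x n.zero_le) ≠ ⊤ := by
  induction n with
  | zero => rwa [comap_towerInclusion_self]
  | succ n ih =>
    have := (hx.isArtinSchreierGenerator_towerCoord h2 n).isQuadraticExtension
    rw [← towerInclusion_comp F x n.zero_le n.le_succ, ← ValuationSubring.comap_comap,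
      ← algebraMap_eq_towerInclusion]
    exact ih (comap_algebraMap_ne_top hB)

end IsTowerSequence

end Tower

section Counting

variable {F : Type*} [Field F]

/-- The number of totally ramified points of `C_{i+k}` over a point of `C_i` at which `x_i` has the
given type. -/
def PlaceType.count : PlaceType → ℕ → ℕ
  | .ramified _, 0 => 1
  | .ramified m, k + 1 => (PlaceType.aboveRamified m).count k
  | .unramifiedPole m, k + 1 => (PlaceType.ramified m).count k + (PlaceType.ramified m).count k
  | .one m, k + 1 => (PlaceType.cubeRoot (m + 1)).count k + (PlaceType.cubeRoot (m + 1)).count k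
  | .cubeRoot m, k + 1 => (PlaceType.ramified m).count k + (PlaceType.one m).count k
  | .generic, k + 1 => PlaceType.generic.count k + PlaceType.generic.count k
  | _, 0 => 0

theorem PlaceType.count_generic (k : ℕ) : PlaceType.generic.count k = 0 := by
  induction k with
  | zero => rfl
  | succ k ih => rw [count, ih]

theorem exists_splitsWithTypes [IsAlgClosed F] {K L : Type*} [Field K] [Field L] [Algebra F K]
    [Algebra F L] [Algebra K L] [IsScalarTower F K L] {A : ValuationSubring K} {t x : K} {y : L}
    {τ : PlaceType} (h : IsArtinSchreierGenerator (x + 1 + 1 / x) y) (ht : IsUniformizer A t)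
    (hA : IsRationalPlace F A) (hx : HasPlaceType F A x τ) (hτ : ∀ m, τ ≠ .ramified m) :
    ∃ τ₁ τ₂, SplitsWithTypes F A y τ₁ τ₂ ∧ τ.count 0 = 0 ∧
      ∀ k, τ.count (k + 1) = τ₁.count k + τ₂.count k := by
  cases τ with
  | ramified m => exact (hτ m rfl).elim
  | unramifiedPole m =>
    exact ⟨_, _, splitsWithTypes_of_unramifiedPole h ht hA hx, rfl, fun _ => rfl⟩
  | one m => exact ⟨_, _, splitsWithTypes_of_one h hA ht hx, rfl, fun _ => rfl⟩
  | cubeRoot m => exact ⟨_, _, splitsWithTypes_of_cubeRoot h hA ht hx, rfl, fun _ => rfl⟩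
  | generic => exact ⟨_, _, splitsWithTypes_of_generic h hA ht hx, rfl, fun _ => rfl⟩

variable {Ω : Type*} [Field Ω] [Algebra F Ω] {x : ℕ → Ω}

/-- The points of `C_n` that are totally ramified in `C_{n+1}` and lie over the place `A` of
`C_i`. -/
def ramifiedPointsOver {i n : ℕ} (h : i ≤ n) (A : ValuationSubring (towerField F x i)) :
    Set (CurvePoint F (towerField F x n)) :=
  {Q ∈ totallyRamifiedPoints F x n | Q.localRing.comap (towerInclusion F x h) = A}

theorem mem_ramifiedPointsOver_self {n : ℕ} {A : ValuationSubring (towerField F x n)}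
    {Q : CurvePoint F (towerField F x n)} :
    Q ∈ ramifiedPointsOver le_rfl A ↔ Q ∈ totallyRamifiedPoints F x n ∧ Q.localRing = A := by
  rw [ramifiedPointsOver, Set.mem_ofPred_eq, comap_towerInclusion_self]

section Step

variable {i n : ℕ} {A : ValuationSubring (towerField F x i)}
  {B B₁ B₂ : ValuationSubring (towerField F x (i + 1))}

theorem mem_ramifiedPointsOver_succ (h : i + 1 ≤ n) {Q : CurvePoint F (towerField F x n)} :
    Q ∈ ramifiedPointsOver (i.le_succ.trans h) A ↔ Q ∈ totallyRamifiedPoints F x n ∧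
      (Q.localRing.comap (towerInclusion F x h)).comap
        (algebraMap (towerField F x i) (towerField F x (i + 1))) = A := by
  rw [ramifiedPointsOver, Set.mem_ofPred_eq, ← towerInclusion_comp F x i.le_succ h,
    ← ValuationSubring.comap_comap, algebraMap_eq_towerInclusion]

theorem ramifiedPointsOver_of_ramifiesInto (h : i + 1 ≤ n) (hAB : RamifiesInto A B) :
    ramifiedPointsOver (i.le_succ.trans h) A = ramifiedPointsOver h B := by
  ext Q
  rw [mem_ramifiedPointsOver_succ h]
  exact and_congr_right fun _ => ⟨hAB.eq_of_comap_eq _, fun hQ => hQ ▸ hAB.comap_eq⟩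

theorem ramifiedPointsOver_of_splitsInto (h : i + 1 ≤ n) (hA : SplitsInto A B₁ B₂) :
    ramifiedPointsOver (i.le_succ.trans h) A =
      ramifiedPointsOver h B₁ ∪ ramifiedPointsOver h B₂ := by
  ext Q
  rw [mem_ramifiedPointsOver_succ h, Set.mem_union]
  constructor
  · rintro ⟨hQ, hQA⟩
    exact (hA.eq_or_eq _ hQA).imp (fun hQB => ⟨hQ, hQB⟩) (fun hQB => ⟨hQ, hQB⟩)
  · rintro (⟨hQ, hQB⟩ | ⟨hQ, hQB⟩)
    · exact ⟨hQ, hQB ▸ hA.comap_left⟩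
    · exact ⟨hQ, hQB ▸ hA.comap_right⟩

theorem encard_ramifiedPointsOver_of_splitsInto (h : i + 1 ≤ n) (hA : SplitsInto A B₁ B₂) :
    (ramifiedPointsOver (i.le_succ.trans h) A).encard =
      (ramifiedPointsOver h B₁).encard + (ramifiedPointsOver h B₂).encard := by
  rw [ramifiedPointsOver_of_splitsInto h hA, Set.encard_union_eq]
  exact Set.disjoint_left.2 fun Q hQ₁ hQ₂ => hA.ne (hQ₁.2.symm.trans hQ₂.2)

end Step

namespace IsTowerSequence

variable (hx : IsTowerSequence F x) (h2 : (2 : F) = 0) {i n : ℕ}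
  {A : ValuationSubring (towerField F x i)}

include hx h2

theorem encard_ramifiedPointsOver_self_of_ramifiesInto
    {B : ValuationSubring (towerField F x (i + 1))} (hA : ∀ c : F, algebraMap F _ c ∈ A)
    (hB : ∀ c : F, algebraMap F _ c ∈ B) (hAB : RamifiesInto A B) :
    (ramifiedPointsOver le_rfl A).encard = 1 := by
  obtain ⟨t, -, ht, -⟩ := hAB.exists_isUniformizer
  refine Set.encard_eq_one.2 ⟨.ofIsUniformizer hA ht, Set.ext fun Q => ?_⟩
  rw [mem_ramifiedPointsOver_self, Set.mem_singleton_iff, CurvePoint.ext_iff]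
  refine and_iff_right_of_imp fun hQ => CurvePoint.isTotallyRamified_of_ramifiesInto ?_ hB
    (hx.isArtinSchreierGenerator_towerCoord h2 i).finrank_eq
  rwa [hQ]

theorem ramifiedPointsOver_self_of_splitsInto
    {B₁ B₂ : ValuationSubring (towerField F x (i + 1))} (hA : SplitsInto A B₁ B₂) :
    ramifiedPointsOver le_rfl A = ∅ := by
  refine Set.eq_empty_of_forall_notMem fun Q hQ => ?_
  obtain ⟨hQram, rfl⟩ := mem_ramifiedPointsOver_self.1 hQ
  refine CurvePoint.not_isTotallyRamified_of_splitsInto hA ?_ hQram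
  rw [(hx.isArtinSchreierGenerator_towerCoord h2 i).finrank_eq]
  exact Nat.succ_ne_self 1

theorem encard_ramifiedPointsOver [IsAlgClosed F] {k : ℕ} (hn : i + k = n) (h : i ≤ n)
    {t : towerField F x i} (ht : IsUniformizer A t) (hA : IsRationalPlace F A) {τ : PlaceType}
    (hτ : HasPlaceType F A (towerCoord F x i) τ) :
    (ramifiedPointsOver h A).encard = τ.count k := by
  have hgen := hx.isArtinSchreierGenerator_towerCoord h2 i
  induction k generalizing i τ with
  | zero =>
    obtain rfl := hn
    by_cases hram : ∃ m, τ = .ramified m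
    · obtain ⟨m, rfl⟩ := hram
      obtain ⟨B, hAB, hB, -⟩ := exists_ramifiesInto_hasPlaceType hgen hA hτ
      exact hx.encard_ramifiedPointsOver_self_of_ramifiesInto h2 hA.algebraMap_mem
        hB.algebraMap_mem hAB
    · obtain ⟨τ₁, τ₂, ⟨B₁, B₂, hsplit, -⟩, hcount, -⟩ :=
        exists_splitsWithTypes hgen ht hA hτ (not_exists.1 hram)
      rw [hcount]
      exact (hx.ramifiedPointsOver_self_of_splitsInto h2 hsplit) ▸ Set.encard_empty
  | succ k ih =>
    have hi : i + 1 ≤ n := by lia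
    have hik : i + 1 + k = n := by lia
    have hgen' := hx.isArtinSchreierGenerator_towerCoord h2 (i + 1)
    by_cases hram : ∃ m, τ = .ramified m
    · obtain ⟨m, rfl⟩ := hram
      obtain ⟨B, hAB, hB, hτB⟩ := exists_ramifiesInto_hasPlaceType hgen hA hτ
      obtain ⟨-, s, -, hs, -⟩ := hAB.exists_isUniformizer
      rw [ramifiedPointsOver_of_ramifiesInto hi hAB]
      exact ih hik hi hs hB hτB hgen'
    · obtain ⟨τ₁, τ₂, ⟨B₁, B₂, hsplit, hτ₁, hτ₂⟩, -, hcount⟩ :=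
        exists_splitsWithTypes hgen ht hA hτ (not_exists.1 hram)
      have ih₁ := ih hik hi
        (hsplit.isImmediate_left.isUniformizer_algebraMap hsplit.comap_left ht)
        (hsplit.isImmediate_left.isRationalPlace hsplit.comap_left hA) hτ₁ hgen'
      have ih₂ := ih hik hi
        (hsplit.isImmediate_right.isUniformizer_algebraMap hsplit.comap_right ht)
        (hsplit.isImmediate_right.isRationalPlace hsplit.comap_right hA) hτ₂ hgen'
      rw [encard_ramifiedPointsOver_of_splitsInto hi hsplit, ih₁, ih₂, hcount, Nat.cast_add]

end IsTowerSequence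

end Counting

section TotalCount

namespace PlaceType

theorem count_ramified_zero (k : ℕ) : (ramified 0).count k = 1 := by
  induction k with
  | zero => rfl
  | succ _ ih => exact ih

theorem count_ramified_succ_add_two (m k : ℕ) :
    (ramified (m + 1)).count (k + 2) = 2 * (ramified m).count k := by
  rw [two_mul]
  rfl

theorem count_ramified_even (m h : ℕ) : (ramified m).count (2 * h) = 2 ^ min m h := by
  induction h generalizing m with
  | zero => rw [Nat.min_zero, pow_zero, mul_zero, count]
  | succ h ih =>
    cases m with
    | zero => rw [count_ramified_zero, Nat.zero_min, pow_zero]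
    | succ m => rw [mul_add_one, count_ramified_succ_add_two, ih, Nat.succ_min_succ, pow_succ']

theorem count_ramified_odd_of_le {m h : ℕ} (hm : m ≤ h) :
    (ramified m).count (2 * h + 1) = 2 ^ m := by
  induction m generalizing h with
  | zero => exact count_ramified_zero _
  | succ m ih =>
    obtain ⟨h, rfl⟩ := Nat.exists_eq_add_of_lt hm
    rw [show 2 * (m + h + 1) + 1 = 2 * (m + h) + 1 + 2 by ring, count_ramified_succ_add_two,
      ih le_self_add, pow_succ']

theorem count_ramified_odd_of_lt {m h : ℕ} (hm : h < m) : (ramified m).count (2 * h + 1) = 0 := by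
  induction h generalizing m with
  | zero =>
    obtain ⟨m, rfl⟩ := Nat.exists_eq_add_of_lt hm
    rfl
  | succ h ih =>
    obtain ⟨m, rfl⟩ := Nat.exists_eq_add_of_lt hm
    rw [show 2 * (h + 1) + 1 = 2 * h + 1 + 2 by ring, count_ramified_succ_add_two,
      ih (by lia), mul_zero]

/-- The number of totally ramified points `k + 1` levels above a point of type `cubeRoot m`, plus
half the number of those above a point of type `one m`. These two types lead to each other, and
this combination satisfies a recursion involving no other count of theirs. -/
def cubeRootPairCount (m k : ℕ) : ℕ :=
  (cubeRoot m).count (k + 1) + (cubeRoot (m + 1)).count k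

theorem cubeRootPairCount_add_two (m k : ℕ) :
    cubeRootPairCount m (k + 2) =
      (ramified m).count (k + 2) + (ramified (m + 1)).count (k + 1) +
        2 * cubeRootPairCount (m + 1) k := by
  simp only [cubeRootPairCount, count]
  ring

theorem cubeRootPairCount_even_of_le {m h : ℕ} (hm : h ≤ m) :
    cubeRootPairCount m (2 * h) = 2 ^ h * (h + 1) := by
  induction h generalizing m with
  | zero => rfl
  | succ h ih =>
    rw [mul_add_one, cubeRootPairCount_add_two, ← mul_add_one, count_ramified_even,
      count_ramified_odd_of_lt (by lia), ih (by lia), min_eq_right hm]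
    ring

theorem cubeRootPairCount_odd_of_lt {m h : ℕ} (hm : h < m) :
    cubeRootPairCount m (2 * h + 1) = 2 ^ h * (h + 1) := by
  induction h generalizing m with
  | zero =>
    obtain ⟨m, rfl⟩ := Nat.exists_eq_add_of_lt hm
    rfl
  | succ h ih =>
    rw [show 2 * (h + 1) + 1 = 2 * h + 1 + 2 by ring, cubeRootPairCount_add_two,
      show 2 * h + 1 + 2 = 2 * (h + 1) + 1 by ring, show 2 * h + 1 + 1 = 2 * (h + 1) by ring,
      count_ramified_odd_of_lt hm, count_ramified_even, ih (by lia), min_eq_right (by lia)]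
    ring

theorem cubeRootPairCount_even (m : ℕ) : ∀ d : ℕ,
    cubeRootPairCount m (2 * (m + d)) + 2 ^ m = 2 ^ (m + d) * (m + d / 2 + 2)
  | 0 => by
    rw [add_zero, cubeRootPairCount_even_of_le le_rfl]
    ring
  | 1 => by
    rw [mul_add_one, cubeRootPairCount_add_two, ← mul_add_one, count_ramified_even,
      count_ramified_odd_of_lt m.lt_succ_self, cubeRootPairCount_even_of_le m.le_succ,
      min_eq_left (by lia), Nat.div_eq_of_lt one_lt_two]
    ring
  | d + 2 => by
    have ih := cubeRootPairCount_even (m + 1) d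
    rw [show 2 * (m + (d + 2)) = 2 * (m + 1 + d) + 2 by ring, cubeRootPairCount_add_two,
      ← mul_add_one, count_ramified_even, count_ramified_odd_of_le le_self_add,
      min_eq_left (by lia), Nat.add_div_right d two_pos]
    linear_combination 2 * ih

theorem cubeRootPairCount_odd (m : ℕ) : ∀ d : ℕ,
    cubeRootPairCount m (2 * (m + d) + 1) + 2 ^ m = 2 ^ (m + d) * (m + d / 2 + 3)
  | 0 => by
    cases m with
    | zero => rfl
    | succ m =>
      rw [show 2 * (m + 1 + 0) + 1 = 2 * m + 1 + 2 by ring, cubeRootPairCount_add_two,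
        show 2 * m + 1 + 2 = 2 * (m + 1) + 1 by ring, show 2 * m + 1 + 1 = 2 * (m + 1) by ring,
        count_ramified_odd_of_le le_rfl, count_ramified_even, min_eq_right (m + 1).le_succ,
        cubeRootPairCount_odd_of_lt (by lia)]
      ring
  | 1 => by
    rw [show 2 * (m + 1) + 1 = 2 * m + 1 + 2 by ring, cubeRootPairCount_add_two,
      show 2 * m + 1 + 2 = 2 * (m + 1) + 1 by ring, show 2 * m + 1 + 1 = 2 * (m + 1) by ring,
      count_ramified_odd_of_le m.le_succ, count_ramified_even, min_self,
      cubeRootPairCount_odd_of_lt m.lt_succ_self, Nat.div_eq_of_lt one_lt_two]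
    ring
  | d + 2 => by
    have ih := cubeRootPairCount_odd (m + 1) d
    rw [show 2 * (m + (d + 2)) + 1 = 2 * (m + 1 + d) + 1 + 2 by ring, cubeRootPairCount_add_two,
      show 2 * (m + 1 + d) + 1 + 2 = 2 * (m + 1 + d + 1) + 1 by ring,
      show 2 * (m + 1 + d) + 1 + 1 = 2 * (m + 1 + d + 1) by ring,
      count_ramified_odd_of_le (by lia), count_ramified_even, min_eq_left (by lia),
      Nat.add_div_right d two_pos]
    linear_combination 2 * ih

/-- The number of totally ramified points of `C_n`: above `x₀ = ∞, 0, 1` and the two primitive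
cube roots of unity. -/
def totalCount (n : ℕ) : ℕ :=
  2 * (ramified 0).count n + (one 0).count n + 2 * (cubeRoot 0).count n

theorem totalCount_succ (k : ℕ) : totalCount (k + 1) = 2 * (cubeRootPairCount 0 k + 1) := by
  rw [totalCount, count_ramified_zero, cubeRootPairCount, count]
  ring

theorem totalCount_even (h : ℕ) : totalCount (2 * h) = ((2 * h + 2) / 4 + 2) * 2 ^ h := by
  cases h with
  | zero => rfl
  | succ h =>
    have hpair := cubeRootPairCount_odd 0 h
    simp only [zero_add, pow_zero] at hpair
    rw [show 2 * (h + 1) = 2 * h + 1 + 1 by ring, totalCount_succ, hpair,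
      show (2 * h + 1 + 1 + 2) / 4 = h / 2 + 1 by lia]
    ring

theorem totalCount_odd (h : ℕ) :
    totalCount (2 * h + 1) = ((2 * h + 1) / 4 + 2) * 2 ^ (h + 1) := by
  have hpair := cubeRootPairCount_even 0 h
  simp only [zero_add, pow_zero] at hpair
  rw [totalCount_succ, hpair, show (2 * h + 1) / 4 = h / 2 by lia]
  ring

end PlaceType

end TotalCount

section Total

open IntermediateField OnePoint

variable {F : Type*} [Field F]

theorem sq_add_self_add_one_eq_zero_iff {ω a : F} (h2 : (2 : F) = 0) (hω : ω ^ 2 + ω + 1 = 0) :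
    a ^ 2 + a + 1 = 0 ↔ a = ω ∨ a = ω + 1 := by
  have hfactor : a ^ 2 + a + 1 = (a - ω) * (a - (ω + 1)) := by grind
  rw [hfactor, mul_eq_zero, sub_eq_zero, sub_eq_zero]

variable {Ω : Type*} [Field Ω] [Algebra F Ω] {x : ℕ → Ω}

variable (x) in
/-- The points of `C_n` that are totally ramified in `C_{n+1}` and lie over the point `x₀ = p` of
the projective line. -/
def ramifiedPointsAt (n : ℕ) (p : OnePoint F) : Set (CurvePoint F (towerField F x n)) :=
  {Q ∈ totallyRamifiedPoints F x n |
    (Q.localRing.comap (towerInclusion F x n.zero_le)).valuation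
      (localParameter (towerCoord F x 0) p) < 1}

theorem CurvePoint.algebraMap_mem_comap_towerInclusion {n : ℕ}
    (Q : CurvePoint F (towerField F x n)) (c : F) :
    algebraMap F _ c ∈ Q.localRing.comap (towerInclusion F x n.zero_le) := by
  have hc : towerInclusion F x n.zero_le (algebraMap F _ c) = algebraMap F _ c :=
    (inclusion (towerField_mono F x n.zero_le)).commutes c
  rw [ValuationSubring.mem_comap, hc]
  exact Q.algebraMap_mem c

namespace IsTowerSequence

variable (hx : IsTowerSequence F x)

include hx

theorem ramifiedPointsAt_eq_ramifiedPointsOver {n : ℕ} {p : OnePoint F}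
    {A : ValuationSubring (towerField F x 0)} (hA : ∀ c : F, algebraMap F _ c ∈ A)
    (hp : A.valuation (localParameter (towerCoord F x 0) p) < 1) :
    ramifiedPointsAt x n p = ramifiedPointsOver n.zero_le A := by
  have htop : F⟮(localParameter (towerCoord F x 0) p : towerField F x 0)⟯ = ⊤ :=
    (adjoin_localParameter _ p).trans adjoin_towerCoord_zero
  have hp0 := localParameter_ne_zero hx.transcendental_towerCoord_zero p
  ext Q
  refine and_congr_right fun _ => ⟨fun hQ => ?_, fun hQ => by rwa [hQ]⟩
  exact eq_of_adjoin_eq_top Q.algebraMap_mem_comap_towerInclusion hQ htop hp0 hA hp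

theorem towerCoord_zero_ne_zero : towerCoord F x 0 ≠ 0 :=
  fun h => hx.transcendental_towerCoord_zero (h ▸ isAlgebraic_zero)

theorem pairwise_disjoint_ramifiedPointsAt (n : ℕ) :
    Pairwise fun p q : OnePoint F => Disjoint (ramifiedPointsAt x n p) (ramifiedPointsAt x n q) :=
  fun _ _ hpq => Set.disjoint_left.2 fun Q hp hq => hpq <|
    eq_of_valuation_localParameter_lt_one Q.algebraMap_mem_comap_towerInclusion
      hx.towerCoord_zero_ne_zero hp.2 hq.2

variable [IsAlgClosed F] (h2 : (2 : F) = 0)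

include h2

theorem encard_ramifiedPointsAt (n : ℕ) {p : OnePoint F} {τ : PlaceType}
    (hτ : ∀ A, IsRationalPlace F A → IsUniformizer A (localParameter (towerCoord F x 0) p) →
      HasPlaceType F A (towerCoord F x 0) τ) :
    (ramifiedPointsAt x n p).encard = τ.count n := by
  obtain ⟨A, hA, hp⟩ := exists_isUniformizer_localParameter adjoin_towerCoord_zero
    hx.transcendental_towerCoord_zero p
  rw [hx.ramifiedPointsAt_eq_ramifiedPointsOver hA.algebraMap_mem hp.valuation_lt_one]
  exact hx.encard_ramifiedPointsOver h2 n.zero_add _ hp hA (hτ A hA hp)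

theorem exists_mem_ramifiedPointsAt {n : ℕ} {Q : CurvePoint F (towerField F x n)}
    (hQ : Q ∈ totallyRamifiedPoints F x n) : ∃ p, Q ∈ ramifiedPointsAt x n p := by
  obtain ⟨t, ht⟩ := Q.exists_isUniformizer
  have hQtop : Q.localRing ≠ ⊤ := fun h => ht.inv_notMem (h ▸ ValuationSubring.mem_top _)
  obtain ⟨p, hp⟩ := exists_valuation_localParameter_lt_one adjoin_towerCoord_zero
    Q.algebraMap_mem_comap_towerInclusion (hx.comap_towerInclusion_ne_top h2 hQtop)
  exact ⟨p, hQ, hp⟩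

theorem ramifiedPointsAt_generic (n : ℕ) {a : F} (ha0 : a ≠ 0) (ha1 : a + 1 ≠ 0)
    (ha : a ^ 2 + a + 1 ≠ 0) : ramifiedPointsAt x n (a : OnePoint F) = ∅ := by
  have hcard := hx.encard_ramifiedPointsAt h2 n (p := a) (τ := .generic) fun A hA hp =>
    hasPlaceType_generic hA.algebraMap_mem ha0 ha1 ha hp.valuation_lt_one
  rwa [PlaceType.count_generic, Nat.cast_zero, Set.encard_eq_zero] at hcard

theorem totallyRamifiedPoints_eq_biUnion (n : ℕ) {ω : F}
    (hω : ω ^ 2 + ω + 1 = 0) :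
    totallyRamifiedPoints F x n =
      ⋃ p ∈ ({∞, ↑(0 : F), ↑(1 : F), ↑ω, ↑(ω + 1)} : Set (OnePoint F)),
        ramifiedPointsAt x n p := by
  ext Q
  refine ⟨fun hQ => ?_, fun hQ => ?_⟩
  · obtain ⟨p, hp⟩ := hx.exists_mem_ramifiedPointsAt h2 hQ
    refine Set.mem_biUnion (x := p) ?_ hp
    cases p with
    | infty => exact Set.mem_insert _ _
    | coe a =>
      have hcases : a = 0 ∨ a + 1 = 0 ∨ a ^ 2 + a + 1 = 0 := by
        by_contra! ha
        exact (hx.ramifiedPointsAt_generic h2 n ha.1 ha.2.1 ha.2.2).subset hp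
      rw [sq_add_self_add_one_eq_zero_iff h2 hω] at hcases
      have ha1 : a + 1 = 0 → a = 1 := by grind
      simpa using hcases.imp_right (Or.imp_left ha1)
  · obtain ⟨p, -, hp⟩ := Set.mem_iUnion₂.1 hQ
    exact hp.1

theorem encard_totallyRamifiedPoints (n : ℕ) :
    (totallyRamifiedPoints F x n).encard = PlaceType.totalCount n := by
  obtain ⟨ω, hω⟩ := exists_sq_add_self_eq (1 : F)
  replace hω : ω ^ 2 + ω + 1 = 0 := by grind
  have h2K : (2 : towerField F x 0) = 0 := two_eq_zero_of_algebra _ h2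
  have hcubeRoot {a : F} (ha : a ^ 2 + a + 1 = 0) :
      (ramifiedPointsAt x n (a : OnePoint F)).encard = (PlaceType.cubeRoot 0).count n :=
    hx.encard_ramifiedPointsAt h2 n fun _ hA hp => hasPlaceType_cubeRoot h2K hA.algebraMap_mem ha hp
  have hω0 : ω ≠ 0 := by grind
  have hω1 : ω ≠ 1 := by grind
  have hω' : ω + 1 ≠ 0 := by grind
  rw [hx.totallyRamifiedPoints_eq_biUnion h2 n hω, (Set.toFinite _).encard_biUnion
      ((hx.pairwise_disjoint_ramifiedPointsAt n).set_pairwise _),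
    finsum_mem_insert _ (by simp) (Set.toFinite _),
    finsum_mem_insert _ (by simp [hω0.symm, hω'.symm]) (Set.toFinite _),
    finsum_mem_insert _ (by simp [hω1.symm, hω0]) (Set.toFinite _),
    finsum_mem_insert _ (by simp) (Set.toFinite _), finsum_mem_singleton,
    hx.encard_ramifiedPointsAt h2 n fun _ hA hp => hasPlaceType_infty hA.algebraMap_mem hp,
    hx.encard_ramifiedPointsAt h2 n fun _ _ hp => hasPlaceType_zero hp,
    hx.encard_ramifiedPointsAt h2 n fun _ _ hp => hasPlaceType_one h2K hp,
    hcubeRoot hω, hcubeRoot ((sq_add_self_add_one_eq_zero_iff h2 hω).2 (.inr rfl)),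
    PlaceType.totalCount]
  push_cast
  ring

end IsTowerSequence

end Total

theorem mainTheorem4_general (F : Type*) [Field F] [CharP F 2] [IsAlgClosed F]
    (Ω : Type*) [Field Ω] [Algebra F Ω] (x : ℕ → Ω) (hx : IsTowerSequence F x) (i : ℕ) :
    (totallyRamifiedPoints F x i).Finite ∧
    (Even i → (totallyRamifiedPoints F x i).ncard = ((i + 2) / 4 + 2) * 2 ^ (i / 2)) ∧
    (Odd i → (totallyRamifiedPoints F x i).ncard = (i / 4 + 2) * 2 ^ ((i + 1) / 2)) := by
  have hcard := hx.encard_totallyRamifiedPoints CharTwo.two_eq_zero i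
  have hncard : (totallyRamifiedPoints F x i).ncard = PlaceType.totalCount i := by
    rw [Set.ncard, hcard, ENat.toNat_natCast]
  refine ⟨Set.finite_of_encard_eq_coe hcard, fun hi => ?_, fun hi => ?_⟩
  · obtain ⟨h, rfl⟩ := even_iff_exists_two_mul.1 hi
    rw [hncard, PlaceType.totalCount_even, Nat.mul_div_cancel_left h two_pos]
  · obtain ⟨h, rfl⟩ := hi
    rw [hncard, PlaceType.totalCount_odd, show (2 * h + 1 + 1) / 2 = h + 1 by lia]

theorem mainTheorem4 (F : Type*) [Field F] [Algebra (ZMod 2) F] [IsAlgClosure (ZMod 2) F]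
    (Ω : Type*) [Field Ω] [Algebra F Ω] (x : ℕ → Ω) (hx : IsTowerSequence F x) (i : ℕ) :
    (totallyRamifiedPoints F x i).Finite ∧
    (Even i → (totallyRamifiedPoints F x i).ncard = ((i + 2) / 4 + 2) * 2 ^ (i / 2)) ∧
    (Odd i → (totallyRamifiedPoints F x i).ncard = (i / 4 + 2) * 2 ^ ((i + 1) / 2)) := by
  have : IsAlgClosed F := IsAlgClosure.isAlgClosed (ZMod 2)
  have : CharP F 2 := charP_of_injective_algebraMap (algebraMap (ZMod 2) F).injective 2
  exact mainTheorem4_general F Ω x hx i
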